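/- Fix $T,d\in\mathbb{N}$. Let $X$ and $X^n$, $n\in\mathbb{N}$, be random vectors in $\mathbb{R}^T$, and $Y$ and $Y^n$ random vectors in $(\mathbb{R}^d)^T$; $(X,Y)$ is defined on a probability space with measure $P$, and $(X^n,Y^n)$ on one with measure $P^n$. Write $(x,y)_{\le t}=((x_1,y_1),\dots,(x_t,y_t))$ and $\mathcal{F}_t=\sigma((X,Y)_{\le t})$, $\mathcal{F}^n_t=\sigma((X^n,Y^n)_{\le t})$, where $\mathcal{F}_0,\mathcal{F}^n_0$ are trivial. A sequence $(\nu_n)$ of laws on $\mathbb{R}$ is uniformly integrable if $\lim_{r\to\infty}\sup_n\int_{\{|x|>r\}}|x|\,\nu_n(dx)=0$. **Conditional risk measures.** Let $\mathcal{P}([0,1])'$ be the set of probability measures on $[0,1]$ that either have a bounded density with respect to Lebesgue measure or have support contained in $[a,b]$ for some $0<a<b<1$. For a random variable $W$ and a sub-$\sigma$-algebra $\mathcal{G}$ let $F^{-1}_{W\mid\mathcal{G}}(p)=\min\{m\in\mathbb{R}:P(W\le m\mid\mathcal{G})\ge p\}$, computed from a regular conditional distribution of $W$ given $\mathcal{G}$.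 Given $\mu_0,\dots,\mu_{T-1}\in\mathcal{P}([0,1])'$, let $$\rho_t(W\mid\mathcal{G})=\int_0^1F^{-1}_{-W\mid\mathcal{G}}(p)\,\mu_t(dp).$$ **Valuation mappings.** For integrable $W$ and $t=0,\dots,T-1$ let $\phi_t(W\mid\mathcal{G})$ be given by one (the same for all $t$) of the following three formulas: 1. $\displaystyle\frac{1}{1+\eta_t}E[W\mid\mathcal{G}]+\frac{\eta_t}{1+\eta_t}\rho_t(-W\mid\mathcal{G})$, with $\eta_t\in[0,\infty)$; 2. $\displaystyle\rho_t(-W\mid\mathcal{G})-\frac{1}{1+\eta_t}E\big[(\rho_t(-W\mid\mathcal{G})-W)^+\mid\mathcal{G}\big]$, with $\eta_t\in[0,\infty)$; 3. $\displaystyle\rho_t(-W\mid\mathcal{G})-E\big[\big((\rho_t(-W\mid\mathcal{G})-W)^+\big)^{\beta_t}\mid\mathcal{G}\big]^{1/\beta_t}$, with $\beta_t\in(0,1]$. Put $\phi_t(W)=\phi_t(W\mid\mathcal{F}_t)$ and $\phi^n_t(W)=\phi_t(W\mid\mathcal{F}^n_t)$, and define backward recursively $$V_T(X)=0,\quad V_t(X)=\phi_t(X_{t+1}+V_{t+1}(X)),\qquad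 V^n_T(X^n)=0,\quad V^n_t(X^n)=\phi^n_t(X^n_{t+1}+V^n_{t+1}(X^n)),\qquad t<T.$$ **Theorem.** Suppose that $\mathcal{L}(X^n,Y^n)\to\mathcal{L}(X,Y)$ weakly as $n\to\infty$, that $\mathcal{L}(X,Y)$ is Gaussian (possibly degenerate), and that $(\mathcal{L}(\Vert X^n\Vert))_n$ is uniformly integrable, where $\Vert\cdot\Vert$ is the Euclidean norm. Fix versions of the regular conditional distributions $\mathcal{L}((X^n,Y^n)\mid(X^n,Y^n)_{\le t}=\cdot)$ and $\mathcal{L}((X,Y)\mid(X,Y)_{\le t}=\cdot)$, and suppose that, for each $t\in\{1,\dots,T\}$ and each convergent sequence $(x^n,y^n)_{\le t}\to(x,y)_{\le t}$ with $(x^n,y^n)_{\le t}\in\operatorname{supp}\mathcal{L}((X^n,Y^n)_{\le t})$ for all $n$ and $(x,y)_{\le t}\in\operatorname{supp}\mathcal{L}((X,Y)_{\le t})$, $$\mathcal{L}\big((X^n,Y^n)\mid(X^n,Y^n)_{\le t}=(x^n,y^n)_{\le t}\big)\to\mathcal{L}\big((X,Y)\mid(X,Y)_{\le t}=(x,y)_{\le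 t}\big)\quad\text{weakly as }n\to\infty,$$ and the sequence $\big(\mathcal{L}(\Vert X^n\Vert\mid(X^n,Y^n)_{\le t}=(x^n,y^n)_{\le t})\big)_n$ is uniformly integrable. Then $V^n_0(X^n)$ and $V_0(X)$ are almost surely constant, $\lim_{n\to\infty}V^n_0(X^n)=V_0(X)$, and almost surely $$V_0(X)=E\Big[\sum_{t=1}^TX_t\Big]+\sum_{t=1}^T\phi_{t-1}(\varepsilon_t)\Big(\operatorname{Var}\Big(\sum_{u=t}^TX_u\mid(X,Y)_{\le t-1}\Big)-\operatorname{Var}\Big(\sum_{u=t}^TX_u\mid(X,Y)_{\le t}\Big)\Big)^{1/2}.$$ Here $\phi_{t-1}(\varepsilon_t)$ is the constant to which $\phi_{t-1}(\varepsilon\mid\mathcal{G})$ is almost surely equal for every standard normal $\varepsilon$, on any probability space, and every sub-$\sigma$-algebra $\mathcal{G}$ independent of $\varepsilon$ (in particular for $\mathcal{G}=\mathcal{F}_{t-1}$); that this constant exists is part of the claim. -/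

import Mathlib

open MeasureTheory ProbabilityTheory Filter Topology
open scoped ENNReal NNReal

universe u v

/-! Times `1, …, T` are indexed by `Fin T`: the index `i` stands for time `i + 1`. -/

/-- The past up to and including time `t` of a path. (Trivial for `t = 0`.) -/
def upTo {T : ℕ} {E : Type*} (t : ℕ) (z : Fin T → E) : {i : Fin T // (i : ℕ) < t} → E :=
  fun i => z i

/-- The process `(X, Y)`. -/
def joint {Ω : Type*} {T d : ℕ} (X : Ω → Fin T → ℝ) (Y : Ω → Fin T → Fin d → ℝ) :
    Ω → Fin T → ℝ × (Fin d → ℝ) :=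
  fun ω i => (X ω i, Y ω i)

/-- `F_t = σ((X, Y)_{≤ t})`; for `t = 0` this is the trivial σ-algebra. -/
@[reducible] def histSigma {Ω : Type*} {T d : ℕ} (X : Ω → Fin T → ℝ) (Y : Ω → Fin T → Fin d → ℝ) (t : ℕ) :
    MeasurableSpace Ω :=
  MeasurableSpace.comap (fun ω => upTo t (joint X Y ω)) inferInstance

/-- The Euclidean norm on `ℝ^T`. -/
noncomputable def euclNorm {T : ℕ} (x : Fin T → ℝ) : ℝ := Real.sqrt (∑ i, x i ^ 2)

/-- The Euclidean norm of the cashflow component of a path of `(X, Y)`. -/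
noncomputable def cashNorm {T d : ℕ} (z : Fin T → ℝ × (Fin d → ℝ)) : ℝ :=
  euclNorm fun i => (z i).1

/-- Uniform integrability of a sequence of laws on `ℝ`. -/
def UnifIntegrableLaws (ν : ℕ → Measure ℝ) : Prop :=
  Tendsto (fun r : ℝ => ⨆ n, ∫⁻ x in {x : ℝ | r < |x|}, ENNReal.ofReal |x| ∂(ν n)) atTop (𝓝 0)

/-- The set `P([0,1])'`: probability measures on `[0,1]` that either have a bounded density with
respect to Lebesgue measure or have support in some `[a, b]` with `0 < a < b < 1`. -/
def IsQuantileWeight (μ : Measure ℝ) : Prop :=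
  IsProbabilityMeasure μ ∧ μ (Set.Icc 0 1)ᶜ = 0 ∧
    ((∃ (C : ℝ≥0) (w : ℝ → ℝ≥0∞), Measurable w ∧ (∀ p, w p ≤ C) ∧
        μ = (volume.restrict (Set.Icc (0 : ℝ) 1)).withDensity w) ∨
      ∃ a b : ℝ, 0 < a ∧ a < b ∧ b < 1 ∧ μ (Set.Icc a b)ᶜ = 0)

/-- The `p`-quantile of a law on `ℝ` (the infimum is a minimum for `0 < p < 1`). -/
noncomputable def quantile (ν : Measure ℝ) (p : ℝ) : ℝ :=
  sInf {x : ℝ | p ≤ ν.real (Set.Iic x)}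

/-- A regular conditional distribution of `W` given the sub-σ-algebra `m`. -/
noncomputable def condLaw {Ω : Type*} (m : MeasurableSpace Ω) {mΩ : MeasurableSpace Ω}
    (P : Measure Ω) [IsFiniteMeasure P] (W : Ω → ℝ) (ω : Ω) : Measure ℝ :=
  @condDistrib Ω Ω ℝ _ _ _ mΩ m W id P _ ω

/-- The conditional risk measure `ρ(W ∣ m) = ∫₀¹ F⁻¹_{-W ∣ m}(p) μ(dp)`. -/
noncomputable def condRisk {Ω : Type*} (μ : Measure ℝ) (m : MeasurableSpace Ω)
    {mΩ : MeasurableSpace Ω} (P : Measure Ω) [IsFiniteMeasure P] (W : Ω → ℝ) (ω : Ω) : ℝ :=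
  ∫ p, quantile (condLaw m P (fun ω' => -W ω') ω) p ∂μ

/-- The three families of one-step valuation mappings, with their time-dependent parameters. -/
inductive ValuationRule where
  | costOfCapital (η : ℕ → ℝ)
  | limitedLiability (η : ℕ → ℝ)
  | powerUtility (β : ℕ → ℝ)

/-- The parameter restrictions: `η_t ≥ 0`, respectively `0 < β_t ≤ 1`, for `t = 0, …, T - 1`. -/
def ValuationRule.Admissible (T : ℕ) : ValuationRule → Prop
  | costOfCapital η => ∀ t < T, 0 ≤ η t
  | limitedLiability η => ∀ t < T, 0 ≤ η t
  | powerUtility β => ∀ t < T, 0 < β t ∧ β t ≤ 1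

/-- The one-step valuation mapping `φ_t`, conditional on the σ-algebra `m`, where the risk measure
at time `t` is given by the weight `μ t`. -/
noncomputable def ValuationRule.phi (k : ValuationRule) (μ : ℕ → Measure ℝ) (t : ℕ) {Ω : Type*}
    (m : MeasurableSpace Ω) {mΩ : MeasurableSpace Ω} (P : Measure Ω) [IsFiniteMeasure P]
    (W : Ω → ℝ) : Ω → ℝ :=
  let R : Ω → ℝ := condRisk (μ t) m P (fun ω => -W ω)
  match k with
  | costOfCapital η => fun ω => 1 / (1 + η t) * (P[W | m]) ω + η t / (1 + η t) * R ω
  | limitedLiability η => fun ω =>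
      R ω - 1 / (1 + η t) * (P[fun ω' => max (R ω' - W ω') 0 | m]) ω
  | powerUtility β => fun ω =>
      R ω - ((P[fun ω' => (max (R ω' - W ω') 0) ^ (β t) | m]) ω) ^ (1 / β t)

/-- The value process: `V_T = 0` and `V_t = φ_t(X_{t+1} + V_{t+1})` for `t < T`, with respect to
the filtration generated by `(X, Y)`. -/
noncomputable def value {Ω : Type*} {mΩ : MeasurableSpace Ω} {T d : ℕ} (k : ValuationRule)
    (μ : ℕ → Measure ℝ) (P : Measure Ω) [IsFiniteMeasure P] (X : Ω → Fin T → ℝ)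
    (Y : Ω → Fin T → Fin d → ℝ) (t : ℕ) : Ω → ℝ :=
  if h : t < T then
    k.phi μ t (histSigma X Y t) P (fun ω => X ω ⟨t, h⟩ + value k μ P X Y (t + 1) ω)
  else fun _ => 0
termination_by T - t

/-- `∑_{u > t} X_u`, the aggregate cashflow strictly after time `t`. -/
noncomputable def remaining {Ω : Type*} {T : ℕ} (X : Ω → Fin T → ℝ) (t : ℕ) (ω : Ω) : ℝ :=
  ∑ i : Fin T, if t ≤ (i : ℕ) then X ω i else 0

/-! Each one-step valuation depends on the payoff only through its conditional law: it is a
functional of laws on the line (`ValuationRule.onLaw`) evaluated at a regular conditional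
distribution. For admissible parameters this functional commutes with maps `x ↦ b + σ x`, `σ ≥ 0`,
and is bounded by a multiple of the first absolute moment. It is also continuous under weak
convergence with uniform integrability if the limit law has no flat quantile level; all Gaussian
laws, Dirac masses included, have this property. Continuity is seen by realising all laws through
their quantile functions on `(0, 1)` with Lebesgue measure: the quantiles converge pointwise, hence
in `L¹` by Vitali's theorem (`ValuationRule.tendsto_onLaw`).

The values then become functions of the observed past, defined pointwise from the given kernels
(`kernelValue`). Backward induction shows that the time-`t` value functions of the prelimit models
converge along pasts `z_n → z` taken in sets of full measure (`tendsto_kernelValue`). In the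
induction step, the extended continuous mapping theorem `le_liminf_measure_preimage` gives weak
convergence of the conditional laws of the next payoff. Uniform integrability comes from a bound of
the value by `C` times the conditional mean of the cashflow norm, with `C` independent of `n`, and
the tower property (`lintegral_nextPayoff_sub_le`). At time `0` there is only one past, so this is
convergence of numbers.

For the formula, backward induction in the Gaussian model gives a value affine in the past, `A z +
b`, where the remaining cashflow minus `A` of the past is independent of the past
(`exists_affine_kernelValue`). Regressing the next payoff on the past leaves a Gaussian residual `ξ`
independent of it, so the valuation adds the mean of `ξ` plus its standard deviation times the value
of a standard normal. What is still unresolved one step later is independent of `ξ`; hence the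
variance of `ξ` is exactly the drop in conditional variance of the remaining cashflow. -/

/-! ### Quantile functions: Galois connection with the distribution function, bounds, convergence.
-/

section Quantile

/-- Right-continuity of the distribution function makes the infimum a minimum; `0 < p < 1` makes the
defining set nonempty and bounded below. Everything about quantiles below goes through this
equivalence. -/
theorem quantile_le_iff (ν : Measure ℝ) [IsProbabilityMeasure ν] {p : ℝ} (hp : p ∈ Set.Ioo (0 : ℝ) 1)
    (x : ℝ) : quantile ν p ≤ x ↔ p ≤ ν.real (Set.Iic x) := by
  have hne : {x : ℝ | p ≤ ν.real (Set.Iic x)}.Nonempty := by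
    obtain ⟨x, hx⟩ := ((tendsto_cdf_atTop ν).eventually (lt_mem_nhds hp.2)).exists
    exact ⟨x, by simpa [cdf_eq_real] using hx.le⟩
  have hbdd : BddBelow {x : ℝ | p ≤ ν.real (Set.Iic x)} := by
    obtain ⟨y, hy⟩ := ((tendsto_cdf_atBot ν).eventually (gt_mem_nhds hp.1)).exists
    refine ⟨y, fun x hx => ?_⟩
    by_contra h
    have := monotone_cdf ν (not_le.1 h).le
    rw [cdf_eq_real ν x] at this
    exact absurd (hx.trans this) (not_le.2 hy)
  constructor
  · intro h
    have hev : ∀ᶠ y in 𝓝[>] x, p ≤ cdf ν y := by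
      filter_upwards [self_mem_nhdsWithin] with y hy
      obtain ⟨z, hz, hzy⟩ := (csInf_lt_iff hbdd hne).1 (lt_of_le_of_lt h hy)
      rw [cdf_eq_real]
      exact le_trans hz (measureReal_mono (Set.Iic_subset_Iic.2 hzy.le))
    have := ge_of_tendsto (((cdf ν).right_continuous x).mono Set.Ioi_subset_Ici_self).tendsto hev
    rwa [cdf_eq_real] at this
  · intro h
    exact csInf_le hbdd h

theorem lt_quantile_iff (ν : Measure ℝ) [IsProbabilityMeasure ν] {p : ℝ}
    (hp : p ∈ Set.Ioo (0 : ℝ) 1) (x : ℝ) : x < quantile ν p ↔ ν.real (Set.Iic x) < p := by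
  simpa using (quantile_le_iff ν hp x).not

theorem monotoneOn_quantile (ν : Measure ℝ) [IsProbabilityMeasure ν] :
    MonotoneOn (quantile ν) (Set.Ioo 0 1) := fun _ hp _ hq hpq =>
  (quantile_le_iff ν hp _).2 (hpq.trans ((quantile_le_iff ν hq _).1 le_rfl))

theorem aemeasurable_quantile (ν : Measure ℝ) [IsProbabilityMeasure ν] :
    AEMeasurable (quantile ν) (volume.restrict (Set.Ioo 0 1)) :=
  aemeasurable_restrict_of_monotoneOn measurableSet_Ioo (monotoneOn_quantile ν)

instance isProbabilityMeasure_restrict_Ioo_zero_one :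
    IsProbabilityMeasure (volume.restrict (Set.Ioo (0 : ℝ) 1)) := ⟨by simp⟩

/-- The quantile function pushes Lebesgue measure on the unit interval forward to the law. -/
theorem map_quantile (ν : Measure ℝ) [IsProbabilityMeasure ν] :
    (volume.restrict (Set.Ioo 0 1)).map (quantile ν) = ν := by
  symm
  refine Measure.ext_of_Iic _ _ fun x => ?_
  rw [Measure.map_apply_of_aemeasurable (aemeasurable_quantile ν) measurableSet_Iic,
    Measure.restrict_apply' measurableSet_Ioo]
  have hset : quantile ν ⁻¹' Set.Iic x ∩ Set.Ioo 0 1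
      = Set.Iic (ν.real (Set.Iic x)) ∩ Set.Ioo 0 1 := by
    ext p
    simp only [Set.mem_inter_iff, Set.mem_preimage, Set.mem_Iic, and_congr_left_iff]
    exact fun hp => quantile_le_iff ν hp x
  have h1 : ν.real (Set.Iic x) ≤ 1 := measureReal_le_one
  have hvol : volume (Set.Iic (ν.real (Set.Iic x)) ∩ Set.Ioo (0 : ℝ) 1)
      = volume (Set.Ioc (0 : ℝ) (ν.real (Set.Iic x))) := by
    apply le_antisymm
    · exact measure_mono fun p hp => ⟨hp.2.1, hp.1⟩
    · rw [← Ioo_ae_eq_Ioc.measure_eq]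
      exact measure_mono fun p hp => ⟨hp.2.le, hp.1, hp.2.trans_le h1⟩
  rw [hset, hvol, Real.volume_Ioc, sub_zero, measureReal_def,
    ENNReal.ofReal_toReal (measure_ne_top _ _)]

theorem integral_comp_quantile (ν : Measure ℝ) [IsProbabilityMeasure ν] {f : ℝ → ℝ}
    (hf : Measurable f) : ∫ p in Set.Ioo 0 1, f (quantile ν p) = ∫ x, f x ∂ν := by
  conv_rhs => rw [← map_quantile ν]
  rw [integral_map (aemeasurable_quantile ν) hf.aestronglyMeasurable]

theorem integrable_quantile {ν : Measure ℝ} [IsProbabilityMeasure ν]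
    (hν : Integrable (fun x => x) ν) : IntegrableOn (quantile ν) (Set.Ioo 0 1) := by
  rw [← map_quantile ν] at hν
  exact (integrable_map_measure (f := quantile ν) (by fun_prop) (aemeasurable_quantile ν)).1 hν

/-- Markov's inequality: beyond any level larger than the bound, the tail mass is less than both `p`
and `1 - p`. -/
theorem abs_quantile_le {ν : Measure ℝ} [IsProbabilityMeasure ν]
    (hν : Integrable (fun x => x) ν) {p : ℝ} (hp : p ∈ Set.Ioo (0 : ℝ) 1) :
    |quantile ν p| ≤ (∫ x, |x| ∂ν) / min p (1 - p) := by
  have hp1 : 0 < 1 - p := by linarith [hp.2]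
  have hmin : 0 < min p (1 - p) := lt_min hp.1 hp1
  have hM : 0 ≤ ∫ x, |x| ∂ν := integral_nonneg fun x => abs_nonneg x
  have hmarkov := mul_meas_ge_le_integral_of_nonneg (μ := ν) (f := fun x : ℝ => |x|)
    (ae_of_all _ fun x => abs_nonneg x) hν.abs
  have hpos : ∀ y, (∫ x, |x| ∂ν) / min p (1 - p) < y →
      ν.real {x | y ≤ |x|} < min p (1 - p) := by
    intro y hy
    have hy0 : 0 < y := lt_of_le_of_lt (div_nonneg hM hmin.le) hy
    rw [div_lt_iff₀ hmin] at hy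
    exact lt_of_mul_lt_mul_left ((hmarkov y).trans_lt hy) hy0.le
  rw [abs_le]
  constructor
  · refine le_of_forall_lt fun y hy => ?_
    rw [lt_quantile_iff ν hp]
    have := hpos (-y) (by linarith)
    refine (measureReal_mono (fun x hx => ?_)).trans_lt (this.trans_le (min_le_left _ _))
    have hx' : x ≤ y := hx
    exact (neg_le_neg hx').trans (neg_le_abs x)
  · refine le_of_forall_gt fun y hy => ?_
    suffices h : ∀ y, (∫ x, |x| ∂ν) / min p (1 - p) < y → quantile ν p ≤ y by
      obtain ⟨z, hz, hzy⟩ := exists_between hy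
      exact (h z hz).trans_lt hzy
    intro y hy
    rw [quantile_le_iff ν hp]
    have h1 := (hpos y hy).trans_le (min_le_right _ _)
    have h2 : ν.real (Set.Ioi y) ≤ ν.real {x | y ≤ |x|} :=
      measureReal_mono fun x hx => (le_of_lt hx).trans (le_abs_self x)
    have h3 := probReal_compl_eq_one_sub (μ := ν) (s := Set.Iic y) measurableSet_Iic
    rw [Set.compl_Iic] at h3
    linarith

theorem quantile_map_affine (ν : Measure ℝ) [IsProbabilityMeasure ν] (b : ℝ) {σ : ℝ} (hσ : 0 ≤ σ)
    {p : ℝ} (hp : p ∈ Set.Ioo (0 : ℝ) 1) :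
    quantile (ν.map fun x => b + σ * x) p = b + σ * quantile ν p := by
  have hm : Measurable fun x : ℝ => b + σ * x := by fun_prop
  have : IsProbabilityMeasure (ν.map fun x => b + σ * x) :=
    Measure.isProbabilityMeasure_map hm.aemeasurable
  refine eq_of_forall_ge_iff fun x => ?_
  rw [quantile_le_iff _ hp, map_measureReal_apply hm measurableSet_Iic]
  -- For `σ = 0` the image is the Dirac mass at `b`, all of whose quantiles in `(0, 1)` are `b`.
  rcases hσ.eq_or_lt with rfl | hσ
  · by_cases hbx : b ≤ x
    · simp [hbx, hp.2.le]
    · simp [hbx, hp.1]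
  · have : (fun x : ℝ => b + σ * x) ⁻¹' Set.Iic x = Set.Iic ((x - b) / σ) := by
      ext y
      simp only [Set.mem_preimage, Set.mem_Iic]
      rw [le_div_iff₀ hσ]
      constructor <;> intro h <;> linarith
    rw [this, ← quantile_le_iff ν hp, le_div_iff₀ hσ]
    constructor <;> intro h <;> linarith

/-- Quantile functions converge pointwise under the open-set condition of the portmanteau theorem
if the limiting law has no flat quantile level. -/
theorem tendsto_quantile {ν : Measure ℝ} [IsProbabilityMeasure ν] {νs : ℕ → Measure ℝ}
    [∀ n, IsProbabilityMeasure (νs n)]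
    (hopen : ∀ G : Set ℝ, IsOpen G → ν G ≤ liminf (fun n => νs n G) atTop)
    {p : ℝ} (hp : p ∈ Set.Ioo (0 : ℝ) 1) (hq : ∀ y, quantile ν p < y → p < ν.real (Set.Iio y)) :
    Tendsto (fun n => quantile (νs n) p) atTop (𝓝 (quantile ν p)) := by
  have key : ∀ (G : Set ℝ) (c : ℝ), IsOpen G → 0 ≤ c → c < ν.real G →
      ∀ᶠ n in atTop, c < (νs n).real G := by
    intro G c hG hc h
    have h' : ENNReal.ofReal c < ν G := by
      rwa [measureReal_def, ← ENNReal.ofReal_lt_iff_lt_toReal hc (measure_ne_top _ _)] at h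
    filter_upwards [eventually_lt_of_lt_liminf (h'.trans_le (hopen G hG))] with n hn
    rwa [measureReal_def, ← ENNReal.ofReal_lt_iff_lt_toReal hc (measure_ne_top _ _)]
  rw [tendsto_order]
  constructor
  · intro y hy
    have h1 := (lt_quantile_iff ν hp y).1 hy
    have h3 := probReal_compl_eq_one_sub (μ := ν) (s := Set.Iic y) measurableSet_Iic
    filter_upwards [key (Set.Iic y)ᶜ (1 - p) isClosed_Iic.isOpen_compl (by linarith [hp.2])
      (by linarith)] with n hn
    rw [lt_quantile_iff _ hp]
    have h4 := probReal_compl_eq_one_sub (μ := νs n) (s := Set.Iic y) measurableSet_Iic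
    linarith
  · intro y hy
    obtain ⟨z, hz, hzy⟩ := exists_between hy
    filter_upwards [key (Set.Iio z) p isOpen_Iio hp.1.le (hq z hz)] with n hn
    refine lt_of_le_of_lt ?_ hzy
    rw [quantile_le_iff _ hp]
    exact hn.le.trans (measureReal_mono Set.Iio_subset_Iic_self)

/-- With positive variance, every interval to the right of the quantile is charged; with variance
zero, the distribution function jumps from `0` to `1` at the mean. In neither case is it flat at a
level strictly between `0` and `1`. -/
theorem lt_measureReal_Iio_of_quantile_lt_gaussianReal (m : ℝ) (v : ℝ≥0) {p : ℝ}
    (hp : p ∈ Set.Ioo (0 : ℝ) 1) {y : ℝ} (hy : quantile (gaussianReal m v) p < y) :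
    p < (gaussianReal m v).real (Set.Iio y) := by
  have h1 := (quantile_le_iff (gaussianReal m v) hp _).1 le_rfl
  set q := quantile (gaussianReal m v) p
  by_cases hv : v = 0
  · subst hv
    rw [gaussianReal_zero_var] at *
    have hmq : m ≤ q := by
      by_contra h
      have : (Measure.dirac m).real (Set.Iic q) = 0 := by
        simp [measureReal_def, h]
      linarith [hp.1]
    have : (Measure.dirac m).real (Set.Iio y) = 1 := by
      simp [measureReal_def, hmq.trans_lt hy]
    linarith [hp.2]
  · have hpos : 0 < (gaussianReal m v).real (Set.Ioo q y) := by
      have : (gaussianReal m v) (Set.Ioo q y) ≠ 0 := by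
        intro h0
        have := gaussianReal_absolutelyContinuous' m hv h0
        simp [hy.not_ge] at this
      exact ENNReal.toReal_pos this (measure_ne_top _ _)
    have hunion : Set.Iio y = Set.Iic q ∪ Set.Ioo q y := by
      rw [Set.Iic_union_Ioo_eq_Iio hy]
    rw [hunion, measureReal_union (s₁ := Set.Iic q) (s₂ := Set.Ioo q y)
      (Set.disjoint_left.2 fun x hx hx' => hx'.1.not_ge hx) measurableSet_Ioo]
    linarith

end Quantile

/-! ### Integrals of quantiles against the weights of the risk measures. -/

section Weight

variable {μ : Measure ℝ}

/-- The working form of the dichotomy: in the first case `μ`-integrals are controlled by `L¹` norms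
on `(0, 1)`, in the second only quantile levels away from `0` and `1` matter. -/
theorem IsQuantileWeight.le_smul_or (hμ : IsQuantileWeight μ) :
    (∃ C : ℝ≥0, μ ≤ C • volume.restrict (Set.Ioo (0 : ℝ) 1)) ∨
      ∃ a b : ℝ, 0 < a ∧ a < b ∧ b < 1 ∧ ∀ᵐ p ∂μ, p ∈ Set.Icc a b := by
  rcases hμ.2.2 with ⟨C, w, hw, hwC, rfl⟩ | ⟨a, b, ha, hab, hb, h⟩
  · refine Or.inl ⟨C, ?_⟩
    rw [Measure.restrict_congr_set (Ioo_ae_eq_Icc (α := ℝ) (μ := volume)).symm]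
    refine (withDensity_mono (g := fun _ => (C : ℝ≥0∞)) (ae_of_all _ hwC)).trans ?_
    rw [withDensity_const]
    rfl
  · exact Or.inr ⟨a, b, ha, hab, hb, h⟩

/-- The levels `0` and `1`, at which the infimum need not be a true quantile, carry no weight. -/
theorem IsQuantileWeight.ae_mem_Ioo (hμ : IsQuantileWeight μ) : ∀ᵐ p ∂μ, p ∈ Set.Ioo (0 : ℝ) 1 := by
  rcases hμ.le_smul_or with ⟨C, hC⟩ | ⟨a, b, ha, -, hb, h⟩
  · have h0 : ∀ᵐ p ∂(C • volume.restrict (Set.Ioo (0 : ℝ) 1)), p ∈ Set.Ioo (0 : ℝ) 1 :=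
      Measure.smul_absolutelyContinuous.ae_le (ae_restrict_mem measurableSet_Ioo)
    exact (Measure.absolutelyContinuous_of_le hC).ae_le h0
  · filter_upwards [h] with p hp using ⟨ha.trans_le hp.1, hp.2.trans_lt hb⟩

theorem IsQuantileWeight.aemeasurable_quantile (hμ : IsQuantileWeight μ) (ν : Measure ℝ)
    [IsProbabilityMeasure ν] : AEMeasurable (quantile ν) μ := by
  have h : AEMeasurable (quantile ν) (μ.restrict (Set.Ioo 0 1)) :=
    aemeasurable_restrict_of_monotoneOn measurableSet_Ioo (monotoneOn_quantile ν)
  rwa [Measure.restrict_eq_self_of_ae_mem hμ.ae_mem_Ioo] at h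

theorem integral_le_mul_of_le_smul {C : ℝ≥0} (hC : μ ≤ C • volume.restrict (Set.Ioo (0 : ℝ) 1))
    {f : ℝ → ℝ} (hf0 : ∀ p, 0 ≤ f p) (hf : IntegrableOn f (Set.Ioo 0 1)) :
    ∫ p, f p ∂μ ≤ C * ∫ p in Set.Ioo 0 1, f p := by
  refine (integral_mono_measure hC (ae_of_all _ hf0) (hf.smul_measure_nnreal)).trans_eq ?_
  rw [integral_smul_nnreal_measure]
  rfl

theorem IsQuantileWeight.integrable_quantile (hμ : IsQuantileWeight μ) {ν : Measure ℝ}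
    [IsProbabilityMeasure ν] (hν : Integrable (fun x => x) ν) : Integrable (quantile ν) μ := by
  have := hμ.1
  rcases hμ.le_smul_or with ⟨C, hC⟩ | ⟨a, b, ha, -, hb, h⟩
  · exact Integrable.mono_measure (Integrable.smul_measure_nnreal (_root_.integrable_quantile hν)) hC
  · refine Integrable.of_bound (hμ.aemeasurable_quantile ν).aestronglyMeasurable
      ((∫ x, |x| ∂ν) / min a (1 - b)) ?_
    filter_upwards [h, hμ.ae_mem_Ioo] with p hp hp'
    refine (abs_quantile_le hν hp').trans ?_
    have : 0 < min a (1 - b) := lt_min ha (by linarith)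
    gcongr
    · exact hp.1
    · exact hp.2

theorem IsQuantileWeight.exists_abs_integral_quantile_le (hμ : IsQuantileWeight μ) :
    ∃ K : ℝ, 0 ≤ K ∧ ∀ (ν : Measure ℝ) [IsProbabilityMeasure ν], Integrable (fun x => x) ν →
      |∫ p, quantile ν p ∂μ| ≤ K * ∫ x, |x| ∂ν := by
  have := hμ.1
  rcases hμ.le_smul_or with ⟨C, hC⟩ | ⟨a, b, ha, hab, hb, h⟩
  · refine ⟨C, C.2, fun ν _ hν => ?_⟩
    rw [← integral_comp_quantile ν (f := fun x => |x|) (by fun_prop)]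
    refine (abs_integral_le_integral_abs).trans ?_
    simpa using integral_le_mul_of_le_smul hC (fun p => abs_nonneg (quantile ν p))
      (_root_.integrable_quantile hν).abs
  · have h0 : 0 < min a (1 - b) := lt_min ha (by linarith)
    refine ⟨(min a (1 - b))⁻¹, (inv_pos.2 h0).le, fun ν _ hν => ?_⟩
    have : ∀ᵐ p ∂μ, ‖quantile ν p‖ ≤ (∫ x, |x| ∂ν) / min a (1 - b) := by
      filter_upwards [h, hμ.ae_mem_Ioo] with p hp hp'
      refine (abs_quantile_le hν hp').trans ?_
      gcongr
      · exact hp.1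
      · exact hp.2
    refine (norm_integral_le_of_norm_le_const this).trans_eq ?_
    simp [div_eq_inv_mul]

theorem IsQuantileWeight.integral_quantile_map_affine (hμ : IsQuantileWeight μ) {ν : Measure ℝ}
    [IsProbabilityMeasure ν] (hν : Integrable (fun x => x) ν) (b : ℝ) {σ : ℝ} (hσ : 0 ≤ σ) :
    ∫ p, quantile (ν.map fun x => b + σ * x) p ∂μ = b + σ * ∫ p, quantile ν p ∂μ := by
  have := hμ.1
  have h : ∀ᵐ p ∂μ, quantile (ν.map fun x => b + σ * x) p = b + σ * quantile ν p := by
    filter_upwards [hμ.ae_mem_Ioo] with p hp using quantile_map_affine ν b hσ hp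
  rw [integral_congr_ae h, integral_add (integrable_const _)
    ((hμ.integrable_quantile hν).const_mul _), integral_const_mul]
  simp

theorem IsQuantileWeight.tendsto_integral_quantile (hμ : IsQuantileWeight μ) {ν : Measure ℝ}
    [IsProbabilityMeasure ν] (hν : Integrable (fun x => x) ν) {νs : ℕ → Measure ℝ}
    [∀ n, IsProbabilityMeasure (νs n)] (hνs : ∀ n, Integrable (fun x => x) (νs n))
    (hpt : ∀ p ∈ Set.Ioo (0 : ℝ) 1, Tendsto (fun n => quantile (νs n) p) atTop (𝓝 (quantile ν p)))
    (hL1 : Tendsto (fun n => ∫ p in Set.Ioo 0 1, |quantile (νs n) p - quantile ν p|) atTop (𝓝 0)) :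
    Tendsto (fun n => ∫ p, quantile (νs n) p ∂μ) atTop (𝓝 (∫ p, quantile ν p ∂μ)) := by
  have := hμ.1
  rcases hμ.le_smul_or with ⟨C, hC⟩ | ⟨a, b, ha, hab, hb, h⟩
  · rw [tendsto_iff_norm_sub_tendsto_zero]
    refine squeeze_zero (fun n => norm_nonneg _) (fun n => ?_) (by simpa using hL1.const_mul (C : ℝ))
    rw [← integral_sub (hμ.integrable_quantile (hνs n)) (hμ.integrable_quantile hν)]
    refine (norm_integral_le_integral_norm _).trans ?_
    exact integral_le_mul_of_le_smul hC (fun p => abs_nonneg _)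
      ((_root_.integrable_quantile (hνs n)).sub (_root_.integrable_quantile hν)).abs
  · have haI : a ∈ Set.Ioo (0 : ℝ) 1 := ⟨ha, by linarith⟩
    have hbI : b ∈ Set.Ioo (0 : ℝ) 1 := ⟨by linarith, hb⟩
    -- By monotonicity, quantiles at levels in `[a, b]` lie between those at `a` and `b`, which form
    -- convergent, hence bounded, sequences. This supplies the dominating constant.
    obtain ⟨A, hA⟩ := (hpt a haI).abs.bddAbove_range
    obtain ⟨B, hB⟩ := (hpt b hbI).abs.bddAbove_range
    refine tendsto_integral_of_dominated_convergence (fun _ => max A B)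
      (fun n => (hμ.aemeasurable_quantile _).aestronglyMeasurable) (integrable_const _) (fun n => ?_) ?_
    · filter_upwards [h] with p hp
      have hpI : p ∈ Set.Ioo (0 : ℝ) 1 := ⟨ha.trans_le hp.1, hp.2.trans_lt hb⟩
      have h1 := monotoneOn_quantile (νs n) haI hpI hp.1
      have h2 := monotoneOn_quantile (νs n) hpI hbI hp.2
      have h3 : |quantile (νs n) a| ≤ A := hA ⟨n, rfl⟩
      have h4 : |quantile (νs n) b| ≤ B := hB ⟨n, rfl⟩
      rw [Real.norm_eq_abs, abs_le]
      have := le_max_left A B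
      have := le_max_right A B
      constructor
      · linarith [(abs_le.1 h3).1]
      · linarith [(abs_le.1 h4).2]
    · filter_upwards [hμ.ae_mem_Ioo] with p hp using hpt p hp

theorem IsQuantileWeight.measurable_integral_quantile (hμ : IsQuantileWeight μ) {α : Type*}
    [MeasurableSpace α] (η : Kernel α ℝ) [IsMarkovKernel η] :
    Measurable fun z => ∫ p, quantile (η z) p ∂μ := by
  have := hμ.1
  classical
  -- Joint measurability in the parameter and the level: on `(0, 1)` the sublevel sets are `p ≤ η z
  -- (Iic c)`. The value `0` elsewhere is invisible to `μ`.
  have hm : Measurable fun x : α × ℝ => if x.2 ∈ Set.Ioo (0 : ℝ) 1 then quantile (η x.1) x.2 else 0 := by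
    refine measurable_of_Iic fun c => ?_
    have : (fun x : α × ℝ => if x.2 ∈ Set.Ioo (0 : ℝ) 1 then quantile (η x.1) x.2 else 0) ⁻¹' Set.Iic c
        = ({x | x.2 ∈ Set.Ioo (0 : ℝ) 1} ∩ {x | x.2 ≤ (η x.1).real (Set.Iic c)}) ∪
          ({x | x.2 ∈ Set.Ioo (0 : ℝ) 1}ᶜ ∩ {_x | 0 ≤ c}) := by
      ext x
      by_cases hx : x.2 ∈ Set.Ioo (0 : ℝ) 1
      · rw [Set.mem_preimage, if_pos hx, Set.mem_Iic, quantile_le_iff _ hx]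
        exact ⟨fun h => Or.inl ⟨hx, h⟩, fun h => h.elim (fun h => h.2) fun h => absurd hx h.1⟩
      · rw [Set.mem_preimage, if_neg hx]
        exact ⟨fun h => Or.inr ⟨hx, h⟩, fun h => h.elim (fun h => absurd h.1 hx) fun h => h.2⟩
    rw [this]
    have h1 : MeasurableSet {x : α × ℝ | x.2 ∈ Set.Ioo (0 : ℝ) 1} := measurable_snd measurableSet_Ioo
    have h2 : Measurable fun x : α × ℝ => (η x.1).real (Set.Iic c) :=
      ((Kernel.measurable_coe η measurableSet_Iic).comp measurable_fst).ennreal_toReal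
    exact (h1.inter (measurableSet_le measurable_snd h2)).union (h1.compl.inter (.const _))
  have h := hm.stronglyMeasurable.integral_prod_right' (ν := μ)
  convert h.measurable using 2 with z
  refine integral_congr_ae ?_
  filter_upwards [hμ.ae_mem_Ioo] with p hp
  simp only [if_pos hp]

end Weight

/-! ### Vitali convergence of quantiles, and integrability of concave powers. -/

section L1

theorem integrable_of_lintegral_ofReal_abs_sub_ne_top {ν : Measure ℝ} [IsFiniteMeasure ν] {r : ℝ}
    (h : ∫⁻ x, ENNReal.ofReal (|x| - r) ∂ν ≠ ∞) : Integrable (fun x => x) ν := by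
  refine ⟨by fun_prop, ?_⟩
  rw [hasFiniteIntegral_iff_norm]
  calc ∫⁻ x, ENNReal.ofReal ‖x‖ ∂ν
      ≤ ∫⁻ x, (ENNReal.ofReal (|x| - r) + ENNReal.ofReal r) ∂ν := by
        refine lintegral_mono fun x => ?_
        rw [Real.norm_eq_abs]
        calc ENNReal.ofReal |x| = ENNReal.ofReal ((|x| - r) + r) := by ring_nf
          _ ≤ _ := ENNReal.ofReal_add_le
    _ = (∫⁻ x, ENNReal.ofReal (|x| - r) ∂ν) + ENNReal.ofReal r * ν Set.univ := by
        rw [lintegral_add_right _ measurable_const, lintegral_const]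
    _ < ∞ := ENNReal.add_lt_top.2 ⟨h.lt_top, ENNReal.mul_lt_top ENNReal.ofReal_lt_top
        (measure_lt_top _ _)⟩

theorem tendsto_integral_abs_quantile_sub {ν : Measure ℝ} [IsProbabilityMeasure ν]
    (hν : Integrable (fun x => x) ν) {νs : ℕ → Measure ℝ} [∀ n, IsProbabilityMeasure (νs n)]
    (hpt : ∀ p ∈ Set.Ioo (0 : ℝ) 1, Tendsto (fun n => quantile (νs n) p) atTop (𝓝 (quantile ν p)))
    (hUI : ∀ ε : ℝ≥0∞, 0 < ε → ∃ r : ℝ, ∀ n, ∫⁻ x, ENNReal.ofReal (|x| - r) ∂(νs n) ≤ ε) :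
    Tendsto (fun n => ∫ p in Set.Ioo 0 1, |quantile (νs n) p - quantile ν p|) atTop (𝓝 0) := by
  have hui : UnifIntegrable (fun n => quantile (νs n)) 1 (volume.restrict (Set.Ioo (0 : ℝ) 1)) := by
    refine unifIntegrable_of le_rfl ENNReal.one_ne_top
      (fun n => (aemeasurable_quantile _).aestronglyMeasurable) fun ε hε => ?_
    obtain ⟨r, hr⟩ := hUI (ENNReal.ofReal (ε / 2)) (by simpa using hε)
    -- The threshold is `2 r` because `|x| ≤ 2 (|x| - r)` as soon as `|x| ≥ 2 r`.
    refine ⟨(2 * r).toNNReal, fun n => ?_⟩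
    have hae : AEMeasurable (fun x : ℝ => ENNReal.ofReal (|x| - r))
        ((volume.restrict (Set.Ioo (0 : ℝ) 1)).map (quantile (νs n))) := by fun_prop
    have h1 := lintegral_map' hae (aemeasurable_quantile (νs n))
    rw [map_quantile] at h1
    rw [eLpNorm_one_eq_lintegral_enorm]
    calc ∫⁻ p in Set.Ioo 0 1, ‖({x | (2 * r).toNNReal ≤ ‖quantile (νs n) x‖₊}.indicator
          (quantile (νs n))) p‖ₑ
        ≤ ∫⁻ p in Set.Ioo 0 1, 2 * ENNReal.ofReal (|quantile (νs n) p| - r) := by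
          refine lintegral_mono fun p => ?_
          by_cases hp : p ∈ {x | (2 * r).toNNReal ≤ ‖quantile (νs n) x‖₊}
          · rw [Set.indicator_of_mem hp, Real.enorm_eq_ofReal_abs]
            have hp' : 2 * r ≤ |quantile (νs n) p| := by
              have := Real.toNNReal_le_iff_le_coe.1 hp
              simpa using this
            rw [show (2 : ℝ≥0∞) = ENNReal.ofReal 2 by simp, ← ENNReal.ofReal_mul (by norm_num)]
            exact ENNReal.ofReal_le_ofReal (by linarith)
          · rw [Set.indicator_of_notMem hp]
            simp
      _ = 2 * ∫⁻ x, ENNReal.ofReal (|x| - r) ∂(νs n) := by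
          rw [lintegral_const_mul' _ _ (by simp), h1]
      _ ≤ 2 * ENNReal.ofReal (ε / 2) := by gcongr; exact hr n
      _ = ENNReal.ofReal ε := by
          rw [show (2 : ℝ≥0∞) = ENNReal.ofReal 2 by simp, ← ENNReal.ofReal_mul (by norm_num)]
          congr 1
          ring
  have hlim := tendsto_Lp_finite_of_tendsto_ae le_rfl ENNReal.one_ne_top
    (fun n => (aemeasurable_quantile (νs n)).aestronglyMeasurable)
    (memLp_one_iff_integrable.2 (integrable_quantile hν)) hui
    ((ae_restrict_iff' measurableSet_Ioo).2 (ae_of_all _ hpt))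
  have hae : ∀ n, AEStronglyMeasurable (quantile (νs n) - quantile ν)
      (volume.restrict (Set.Ioo (0 : ℝ) 1)) := fun n =>
    ((aemeasurable_quantile _).sub (aemeasurable_quantile _)).aestronglyMeasurable
  have h2 := (ENNReal.tendsto_toReal ENNReal.zero_ne_top).comp hlim
  refine h2.congr fun n => ?_
  rw [Function.comp_apply, eLpNorm_one_eq_lintegral_enorm,
    ← integral_norm_eq_lintegral_enorm (hae n)]
  rfl

theorem integrable_rpow_of_integrable {α : Type*} [MeasurableSpace α] {P : Measure α}
    [IsFiniteMeasure P] {β : ℝ} (hβ0 : 0 < β) (hβ1 : β ≤ 1) {f : α → ℝ} (hf0 : ∀ x, 0 ≤ f x)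
    (hf : Integrable f P) : Integrable (fun x => f x ^ β) P := by
  refine Integrable.mono' ((integrable_const (1 : ℝ)).add hf)
    ((Real.continuous_rpow_const hβ0.le).comp_aestronglyMeasurable hf.1) (ae_of_all _ fun x => ?_)
  rw [Real.norm_of_nonneg (Real.rpow_nonneg (hf0 x) _), Pi.add_apply]
  calc f x ^ β ≤ (1 + f x) ^ β := Real.rpow_le_rpow (hf0 x) (by linarith) hβ0.le
    _ ≤ (1 + f x) ^ (1 : ℝ) := Real.rpow_le_rpow_of_exponent_le (by linarith [hf0 x]) hβ1
    _ = 1 + f x := Real.rpow_one _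

theorem integral_rpow_le_rpow_integral {α : Type*} [MeasurableSpace α] {P : Measure α}
    [IsProbabilityMeasure P] {β : ℝ} (hβ0 : 0 < β) (hβ1 : β ≤ 1) {f : α → ℝ} (hf0 : ∀ x, 0 ≤ f x)
    (hf : Integrable f P) : ∫ x, f x ^ β ∂P ≤ (∫ x, f x ∂P) ^ β := by
  have hint := integrable_rpow_of_integrable hβ0 hβ1 hf0 hf
  exact ConcaveOn.le_map_integral (Real.concaveOn_rpow hβ0.le hβ1)
    (Real.continuous_rpow_const hβ0.le).continuousOn isClosed_Ici (ae_of_all _ hf0) hf hint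

end L1

/-! ### The valuation as a functional of laws: growth, affine equivariance, measurability,
continuity. -/

section OnLaw

/-- The value of the valuation mapping `φ_t` on a law. -/
noncomputable def ValuationRule.onLaw (k : ValuationRule) (μ : ℕ → Measure ℝ) (t : ℕ)
    (ν : Measure ℝ) : ℝ :=
  let R : ℝ := ∫ p, quantile ν p ∂(μ t)
  match k with
  | costOfCapital η => 1 / (1 + η t) * (∫ x, x ∂ν) + η t / (1 + η t) * R
  | limitedLiability η => R - 1 / (1 + η t) * ∫ x, max (R - x) 0 ∂ν
  | powerUtility β => R - (∫ x, (max (R - x) 0) ^ (β t) ∂ν) ^ (1 / β t)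

variable {T : ℕ} {k : ValuationRule} {μ : ℕ → Measure ℝ} {t : ℕ}

theorem integrable_max_sub {ν : Measure ℝ} [IsFiniteMeasure ν] (hν : Integrable (fun x => x) ν)
    (R : ℝ) : Integrable (fun x => max (R - x) 0) ν :=
  ((integrable_const R).sub hν).pos_part

theorem integral_max_sub_le {ν : Measure ℝ} [IsProbabilityMeasure ν]
    (hν : Integrable (fun x => x) ν) (R : ℝ) :
    ∫ x, max (R - x) 0 ∂ν ≤ |R| + ∫ x, |x| ∂ν := by
  calc ∫ x, max (R - x) 0 ∂ν ≤ ∫ x, (|R| + |x|) ∂ν := by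
        refine integral_mono (integrable_max_sub hν R) ((integrable_const _).add hν.abs) fun x => ?_
        refine max_le ?_ (by positivity)
        exact (le_abs_self _).trans (abs_sub _ _)
    _ = _ := by
        rw [integral_add (integrable_const _) hν.abs]
        simp

theorem ValuationRule.exists_abs_onLaw_le (hk : k.Admissible T) (ht : t < T)
    (hμ : IsQuantileWeight (μ t)) :
    ∃ K : ℝ, 0 ≤ K ∧ ∀ (ν : Measure ℝ) [IsProbabilityMeasure ν], Integrable (fun x => x) ν →
      |k.onLaw μ t ν| ≤ K * ∫ x, |x| ∂ν := by
  obtain ⟨K, hK0, hK⟩ := hμ.exists_abs_integral_quantile_le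
  cases k with
  | costOfCapital η =>
    have hη : 0 ≤ η t := hk t ht
    refine ⟨|1 / (1 + η t)| + |η t / (1 + η t)| * K, by positivity, fun ν _ hν => ?_⟩
    simp only [onLaw]
    refine (abs_add_le _ _).trans ?_
    rw [abs_mul, abs_mul, add_mul, mul_assoc]
    gcongr
    · exact abs_integral_le_integral_abs
    · exact hK ν hν
  | limitedLiability η =>
    refine ⟨K + |1 / (1 + η t)| * (K + 1), by positivity, fun ν _ hν => ?_⟩
    simp only [onLaw]
    refine (abs_sub _ _).trans ?_
    rw [abs_mul, add_mul, mul_assoc]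
    gcongr
    · exact hK ν hν
    · rw [abs_of_nonneg (integral_nonneg fun x => le_max_right _ _)]
      refine (integral_max_sub_le hν _).trans ?_
      linarith [hK ν hν]
  | powerUtility β =>
    obtain ⟨hβ0, hβ1⟩ : 0 < β t ∧ β t ≤ 1 := hk t ht
    refine ⟨K + (K + 1), by positivity, fun ν _ hν => ?_⟩
    simp only [onLaw]
    refine (abs_sub _ _).trans ?_
    rw [add_mul]
    gcongr
    · exact hK ν hν
    · have h0 : ∀ R : ℝ, 0 ≤ ∫ x, max (R - x) 0 ^ β t ∂ν := fun R =>
        integral_nonneg fun x => Real.rpow_nonneg (le_max_right _ _) _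
      rw [abs_of_nonneg (Real.rpow_nonneg (h0 _) _)]
      calc (∫ x, max ((∫ p, quantile ν p ∂(μ t)) - x) 0 ^ β t ∂ν) ^ (1 / β t)
          ≤ ((∫ x, max ((∫ p, quantile ν p ∂(μ t)) - x) 0 ∂ν) ^ β t) ^ (1 / β t) :=
            Real.rpow_le_rpow (h0 _) (integral_rpow_le_rpow_integral hβ0 hβ1
              (fun x => le_max_right _ _) (integrable_max_sub hν _)) (by positivity)
        _ = ∫ x, max ((∫ p, quantile ν p ∂(μ t)) - x) 0 ∂ν := by
            have h1 : 0 ≤ ∫ x, max ((∫ p, quantile ν p ∂(μ t)) - x) 0 ∂ν :=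
              integral_nonneg fun x => le_max_right _ _
            rw [one_div, Real.rpow_rpow_inv h1 hβ0.ne']
        _ ≤ _ := (integral_max_sub_le hν _).trans (by linarith [hK ν hν])

/-- The risk term is itself equivariant, and the shortfall `(R - x)⁺` ignores the shift and scales
by `σ`; the exponents `β` and `1/β` cancel. In the first rule the two weights sum to one. -/
theorem ValuationRule.onLaw_map_affine (hk : k.Admissible T) (ht : t < T)
    (hμ : IsQuantileWeight (μ t)) {ν : Measure ℝ} [IsProbabilityMeasure ν]
    (hν : Integrable (fun x => x) ν) (b : ℝ) {σ : ℝ} (hσ : 0 ≤ σ) :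
    k.onLaw μ t (ν.map fun x => b + σ * x) = b + σ * k.onLaw μ t ν := by
  have hm : AEMeasurable (fun x : ℝ => b + σ * x) ν := by fun_prop
  have hR := hμ.integral_quantile_map_affine hν b hσ
  have hmax : ∀ R x : ℝ, max (b + σ * R - (b + σ * x)) 0 = σ * max (R - x) 0 := by
    intro R x
    rw [mul_max_of_nonneg _ _ hσ]
    congr 1 <;> ring
  cases k with
  | costOfCapital η =>
    have hη : 0 ≤ η t := hk t ht
    simp only [onLaw]
    rw [hR, integral_map hm (by fun_prop), integral_add (integrable_const _) (hν.const_mul _),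
      integral_const_mul]
    simp only [integral_const, probReal_univ, one_smul]
    field_simp
    ring
  | limitedLiability η =>
    simp only [onLaw]
    rw [hR, integral_map hm (by fun_prop)]
    simp only [hmax]
    rw [integral_const_mul]
    ring
  | powerUtility β =>
    obtain ⟨hβ0, hβ1⟩ : 0 < β t ∧ β t ≤ 1 := hk t ht
    simp only [onLaw]
    have hpow : ∀ R : ℝ, Measurable fun x : ℝ => max (R - x) 0 ^ β t := fun R => by fun_prop
    rw [hR, integral_map hm (hpow _).aestronglyMeasurable]
    simp only [hmax]
    simp_rw [fun x => Real.mul_rpow (z := β t) hσ (le_max_right ((∫ p, quantile ν p ∂(μ t)) - x) 0)]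
    rw [integral_const_mul, Real.mul_rpow (Real.rpow_nonneg hσ _)
      (integral_nonneg fun x => Real.rpow_nonneg (le_max_right _ _) _), one_div,
      Real.rpow_rpow_inv hσ hβ0.ne']
    ring

theorem ValuationRule.measurable_onLaw (hμ : IsQuantileWeight (μ t)) (k : ValuationRule)
    {α : Type*} [MeasurableSpace α] (η : Kernel α ℝ) [IsMarkovKernel η] :
    Measurable fun z => k.onLaw μ t (η z) := by
  have hR := hμ.measurable_integral_quantile η
  have hint : ∀ f : α × ℝ → ℝ, Measurable f → Measurable fun z => ∫ x, f (z, x) ∂(η z) :=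
    fun f hf => (hf.stronglyMeasurable.integral_kernel_prod_right').measurable
  cases k with
  | costOfCapital _ =>
    exact ((hint _ measurable_snd).const_mul _).add (hR.const_mul _)
  | limitedLiability _ =>
    exact hR.sub ((hint (fun y => max ((∫ p, quantile (η y.1) p ∂(μ t)) - y.2) 0)
      (((hR.comp measurable_fst).sub measurable_snd).max measurable_const)).const_mul _)
  | powerUtility β =>
    exact hR.sub ((hint (fun y => max ((∫ p, quantile (η y.1) p ∂(μ t)) - y.2) 0 ^ β t)
      ((((hR.comp measurable_fst).sub measurable_snd).max measurable_const).pow_const _)).pow_const _)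

/-- Subadditivity of `x ↦ x ^ β` on the half-line for `0 < β ≤ 1`. -/
theorem abs_rpow_sub_rpow_le {β : ℝ} (hβ0 : 0 < β) (hβ1 : β ≤ 1) {a b : ℝ} (ha : 0 ≤ a)
    (hb : 0 ≤ b) : |a ^ β - b ^ β| ≤ |a - b| ^ β := by
  have key : ∀ a b : ℝ, 0 ≤ a → 0 ≤ b → a ^ β - b ^ β ≤ |a - b| ^ β := by
    intro a b ha hb
    have h1 : a ^ β ≤ (b + |a - b|) ^ β :=
      Real.rpow_le_rpow ha (by linarith [le_abs_self (a - b)]) hβ0.le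
    linarith [Real.rpow_add_le_add_rpow hb (abs_nonneg (a - b)) hβ0.le hβ1]
  rw [abs_le]
  refine ⟨?_, key a b ha hb⟩
  have := key b a hb ha
  rw [abs_sub_comm] at this
  linarith

/-- Continuity of the valuation mappings on laws: weak convergence, in the open-set form, together
with uniform integrability. -/
theorem ValuationRule.tendsto_onLaw (hk : k.Admissible T) (ht : t < T)
    (hμ : IsQuantileWeight (μ t)) {ν : Measure ℝ} [IsProbabilityMeasure ν]
    (hν : Integrable (fun x => x) ν)
    (hq : ∀ p ∈ Set.Ioo (0 : ℝ) 1, ∀ y, quantile ν p < y → p < ν.real (Set.Iio y))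
    {νs : ℕ → Measure ℝ} [∀ n, IsProbabilityMeasure (νs n)]
    (hopen : ∀ G : Set ℝ, IsOpen G → ν G ≤ liminf (fun n => νs n G) atTop)
    (hUI : ∀ ε : ℝ≥0∞, 0 < ε → ∃ r : ℝ, ∀ n, ∫⁻ x, ENNReal.ofReal (|x| - r) ∂(νs n) ≤ ε) :
    Tendsto (fun n => k.onLaw μ t (νs n)) atTop (𝓝 (k.onLaw μ t ν)) := by
  have hνs : ∀ n, Integrable (fun x => x) (νs n) := by
    obtain ⟨r, hr⟩ := hUI 1 one_pos
    exact fun n => integrable_of_lintegral_ofReal_abs_sub_ne_top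
      ((hr n).trans_lt ENNReal.one_lt_top).ne
  have hpt : ∀ p ∈ Set.Ioo (0 : ℝ) 1,
      Tendsto (fun n => quantile (νs n) p) atTop (𝓝 (quantile ν p)) :=
    fun p hp => tendsto_quantile hopen hp (hq p hp)
  -- From here on all laws live on the common space `(0, 1)` as quantile functions, and each term of
  -- the valuation is estimated by `L¹` distances there.
  have hL1 := tendsto_integral_abs_quantile_sub hν hpt hUI
  have hR := hμ.tendsto_integral_quantile hν hνs hpt hL1
  set R := ∫ p, quantile ν p ∂(μ t) with hRdef
  set Rs := fun n => ∫ p, quantile (νs n) p ∂(μ t) with hRsdef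
  have hi := integrable_quantile hν
  have his := fun n => integrable_quantile (hνs n)
  have hmean : Tendsto (fun n => ∫ x, x ∂(νs n)) atTop (𝓝 (∫ x, x ∂ν)) := by
    rw [tendsto_iff_norm_sub_tendsto_zero]
    refine squeeze_zero (fun n => norm_nonneg _) (fun n => ?_) hL1
    rw [← integral_comp_quantile ν measurable_id', ← integral_comp_quantile (νs n) measurable_id',
      ← integral_sub (his n) hi]
    exact norm_integral_le_integral_norm _
  have hmaxi : Integrable (fun p => max (R - quantile ν p) 0) (volume.restrict (Set.Ioo 0 1)) :=
    ((integrable_const R).sub hi).pos_part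
  have hmaxis : ∀ n, Integrable (fun p => max (Rs n - quantile (νs n) p) 0)
      (volume.restrict (Set.Ioo 0 1)) := fun n => ((integrable_const _).sub (his n)).pos_part
  have hmaxL1 : Tendsto (fun n => ∫ p in Set.Ioo 0 1,
      |max (Rs n - quantile (νs n) p) 0 - max (R - quantile ν p) 0|) atTop (𝓝 0) := by
    refine squeeze_zero (g := fun n => |Rs n - R|
        + ∫ p in Set.Ioo 0 1, |quantile (νs n) p - quantile ν p|)
      (fun n => integral_nonneg fun p => abs_nonneg _) (fun n => ?_) ?_
    · calc _ ≤ ∫ p in Set.Ioo 0 1, (|Rs n - R| + |quantile (νs n) p - quantile ν p|) := by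
            refine integral_mono ((hmaxis n).sub hmaxi).abs
              ((integrable_const _).add ((his n).sub hi).abs) fun p => ?_
            refine (abs_max_sub_max_le_abs _ _ _).trans ?_
            rw [show Rs n - quantile (νs n) p - (R - quantile ν p)
              = (Rs n - R) - (quantile (νs n) p - quantile ν p) by ring]
            exact abs_sub _ _
        _ = _ := by
            have hd : Integrable (fun p => |quantile (νs n) p - quantile ν p|)
              (volume.restrict (Set.Ioo 0 1)) := ((his n).sub hi).abs
            rw [integral_add (integrable_const _) hd]
            simp
    · have := (tendsto_iff_norm_sub_tendsto_zero.1 hR).add hL1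
      simpa using this
  cases k with
  | costOfCapital η => exact (hmean.const_mul _).add (hR.const_mul _)
  | limitedLiability η =>
    refine hR.sub (Tendsto.const_mul _ ?_)
    rw [tendsto_iff_norm_sub_tendsto_zero]
    refine squeeze_zero (fun n => norm_nonneg _) (fun n => ?_) hmaxL1
    rw [← integral_comp_quantile ν (f := fun x => max (R - x) 0) (by fun_prop),
      ← integral_comp_quantile (νs n) (f := fun x => max (Rs n - x) 0) (by fun_prop),
      ← integral_sub (hmaxis n) hmaxi]
    exact norm_integral_le_integral_norm _
  | powerUtility β =>
    obtain ⟨hβ0, hβ1⟩ : 0 < β t ∧ β t ≤ 1 := hk t ht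
    refine hR.sub (Tendsto.rpow_const ?_ (Or.inr (by positivity)))
    rw [tendsto_iff_norm_sub_tendsto_zero]
    refine squeeze_zero (fun n => norm_nonneg _) (fun n => ?_)
      (by simpa [Real.zero_rpow hβ0.ne'] using hmaxL1.rpow_const (p := β t) (Or.inr hβ0.le))
    have hdi := ((hmaxis n).sub hmaxi).abs
    have hpi := integrable_rpow_of_integrable hβ0 hβ1 (fun p => le_max_right _ _) hmaxi
    have hpis := integrable_rpow_of_integrable hβ0 hβ1 (fun p => le_max_right _ _) (hmaxis n)
    rw [← integral_comp_quantile ν (f := fun x => max (R - x) 0 ^ β t) (by fun_prop),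
      ← integral_comp_quantile (νs n) (f := fun x => max (Rs n - x) 0 ^ β t) (by fun_prop),
      ← integral_sub hpis hpi]
    refine (norm_integral_le_integral_norm _).trans ?_
    refine le_trans ?_ (integral_rpow_le_rpow_integral hβ0 hβ1 (fun p => abs_nonneg _) hdi)
    exact integral_mono (hpis.sub hpi).abs
      (integrable_rpow_of_integrable hβ0 hβ1 (fun p => abs_nonneg _) hdi)
      fun p => abs_rpow_sub_rpow_le hβ0 hβ1 (le_max_right _ _) (le_max_right _ _)

end OnLaw

/-! ### From conditional valuations to the law functional at the conditional law. -/

section Conditional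

variable {T : ℕ} {k : ValuationRule} {μ : ℕ → Measure ℝ} {t : ℕ}

theorem condDistrib_ae_eq_of_hasCondDistrib {Ω α : Type*} [MeasurableSpace Ω] [MeasurableSpace α]
    {P : Measure Ω} [IsFiniteMeasure P] {Z : Ω → α} (hZ : Measurable Z) {W : Ω → ℝ}
    (hW : AEMeasurable W P) {η : Kernel α ℝ} [IsMarkovKernel η] (h : HasCondDistrib W Z η P) :
    ∀ᵐ ω ∂P, condDistrib W Z P (Z ω) = η (Z ω) :=
  ae_of_ae_map hZ.aemeasurable (condDistrib_ae_eq_of_measure_eq_compProd Z hW h.map_eq)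

theorem integrable_condDistrib_ae {Ω α : Type*} [MeasurableSpace Ω] [MeasurableSpace α]
    {P : Measure Ω} [IsFiniteMeasure P] {Z : Ω → α} (hZ : Measurable Z) {W : Ω → ℝ}
    (hW : Integrable W P) : ∀ᵐ ω ∂P, Integrable (fun x => x) (condDistrib W Z P (Z ω)) := by
  have h : Integrable (fun x : α × ℝ => x.2) (P.map fun ω => (Z ω, W ω)) :=
    (integrable_map_measure measurable_snd.aestronglyMeasurable
      (hZ.aemeasurable.prodMk hW.1.aemeasurable)).2 hW
  exact h.condDistrib_ae hZ.aemeasurable hW.1.aemeasurable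

theorem condExp_prod_ae_eq_integral_condDistrib_of_measurable {Ω α : Type*} [MeasurableSpace Ω]
    [mα : MeasurableSpace α] {P : Measure Ω} [IsFiniteMeasure P] {Z : Ω → α} (hZ : Measurable Z)
    {W : Ω → ℝ} (hW : AEMeasurable W P) {f : α × ℝ → ℝ} (hf : Measurable f)
    (hf_int : Integrable (fun ω => f (Z ω, W ω)) P) :
    P[fun ω => f (Z ω, W ω) | mα.comap Z] =ᵐ[P] fun ω => ∫ x, f (Z ω, x) ∂(condDistrib W Z P (Z ω)) :=
  condExp_prod_ae_eq_integral_condDistrib hZ hW hf.stronglyMeasurable hf_int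

theorem condLaw_ae_eq {Ω : Type*} {m : MeasurableSpace Ω} {mΩ : MeasurableSpace Ω}
    {P : Measure Ω} [IsFiniteMeasure P] (hm : m ≤ mΩ) {W : Ω → ℝ} (hW : AEMeasurable W P)
    {η : @Kernel Ω ℝ m _} [IsMarkovKernel η]
    (h : @HasCondDistrib Ω Ω ℝ mΩ m _ W id η P) :
    ∀ᵐ ω ∂P, condLaw m P W ω = η ω :=
  @condDistrib_ae_eq_of_hasCondDistrib Ω Ω mΩ m P _ id (measurable_id'' hm) W hW η _ h

instance isProbabilityMeasure_condLaw {Ω : Type*} {m : MeasurableSpace Ω} {mΩ : MeasurableSpace Ω}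
    {P : Measure Ω} [IsFiniteMeasure P] (W : Ω → ℝ) (ω : Ω) :
    IsProbabilityMeasure (condLaw m P W ω) := by
  unfold condLaw
  infer_instance

theorem integrable_condLaw_ae {Ω : Type*} {m : MeasurableSpace Ω} {mΩ : MeasurableSpace Ω}
    {P : Measure Ω} [IsFiniteMeasure P] (hm : m ≤ mΩ) {W : Ω → ℝ} (hW : Integrable W P) :
    ∀ᵐ ω ∂P, Integrable (fun x => x) (condLaw m P W ω) :=
  @integrable_condDistrib_ae Ω Ω mΩ m P _ id (measurable_id'' hm) W hW

/-- Freezing of known quantities: needed because the shortfall involves the conditional risk, which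
is random but `m`-measurable. -/
theorem condExp_prod_ae_eq_integral_condLaw {Ω : Type*} {m : MeasurableSpace Ω}
    {mΩ : MeasurableSpace Ω} {P : Measure Ω} [IsFiniteMeasure P] (hm : m ≤ mΩ) {W : Ω → ℝ}
    (hW : AEMeasurable W P) {f : Ω × ℝ → ℝ} (hf : Measurable[m.prod inferInstance] f)
    (hf_int : Integrable (fun ω => f (ω, W ω)) P) :
    P[fun ω => f (ω, W ω) | m] =ᵐ[P] fun ω => ∫ x, f (ω, x) ∂(condLaw m P W ω) := by
  have h := @condExp_prod_ae_eq_integral_condDistrib_of_measurable Ω Ω mΩ m P _ id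
    (measurable_id'' hm) W hW f hf hf_int
  rw [MeasurableSpace.comap_id] at h
  exact h

/-- Stated over an arbitrary measurable space, like the next two measurability facts, so that it
also serves for `Ω` carrying the smaller σ-algebra `m`. -/
theorem measurable_abs_snd {α : Type*} [MeasurableSpace α] : Measurable fun x : α × ℝ => |x.2| := by
  fun_prop

theorem IsQuantileWeight.measurable_max_integral_quantile_sub {ρ : Measure ℝ}
    (hρ : IsQuantileWeight ρ) {α : Type*} [MeasurableSpace α] (η : Kernel α ℝ) [IsMarkovKernel η] :
    Measurable fun x : α × ℝ => max ((∫ p, quantile (η x.1) p ∂ρ) - x.2) 0 :=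
  (((hρ.measurable_integral_quantile η).comp measurable_fst).sub measurable_snd).max measurable_const

theorem measurable_rpow_const_comp {α : Type*} [MeasurableSpace α] {f : α → ℝ} (hf : Measurable f)
    (β : ℝ) : Measurable fun x => f x ^ β := hf.pow_const β

theorem condRisk_neg_eq {Ω : Type*} (ρ : Measure ℝ) {m : MeasurableSpace Ω}
    {mΩ : MeasurableSpace Ω} {P : Measure Ω} [IsFiniteMeasure P] (W : Ω → ℝ) :
    condRisk ρ m P (fun ω => -W ω) = fun ω => ∫ p, quantile (condLaw m P W ω) p ∂ρ := by
  unfold condRisk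
  simp

theorem integrable_integral_quantile_condLaw {Ω : Type*} {ρ : Measure ℝ} (hρ : IsQuantileWeight ρ)
    {m : MeasurableSpace Ω} {mΩ : MeasurableSpace Ω} {P : Measure Ω} [IsFiniteMeasure P]
    (hm : m ≤ mΩ) {W : Ω → ℝ} (hW : Integrable W P) :
    Integrable (fun ω => ∫ p, quantile (condLaw m P W ω) p ∂ρ) P := by
  have hmeas : Measurable[m] fun ω => ∫ p, quantile (condLaw m P W ω) p ∂ρ :=
    @IsQuantileWeight.measurable_integral_quantile ρ hρ Ω m (@condDistrib Ω Ω ℝ _ _ _ mΩ m W id P _) _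
  obtain ⟨K, hK0, hK⟩ := hρ.exists_abs_integral_quantile_le
  have h := condExp_prod_ae_eq_integral_condLaw hm hW.1.aemeasurable (f := fun x => |x.2|)
    (@measurable_abs_snd Ω m) hW.abs
  -- The dominating function is `K` times the conditional expectation of `|W|`.
  refine Integrable.mono' ((integrable_condExp (m := m) (f := fun ω => |W ω|)).const_mul K)
    (hmeas.mono hm le_rfl).aestronglyMeasurable ?_
  filter_upwards [h, integrable_condLaw_ae hm hW] with ω h1 h2
  rw [h1]
  exact hK _ h2

/-- The valuation mapping evaluates the law functional on the conditional law. -/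
theorem ValuationRule.phi_ae_eq_onLaw (hk : k.Admissible T) (ht : t < T)
    (hμ : IsQuantileWeight (μ t)) {Ω : Type*} {m : MeasurableSpace Ω}
    {mΩ : MeasurableSpace Ω} {P : Measure Ω} [IsFiniteMeasure P] (hm : m ≤ mΩ)
    {W : Ω → ℝ} (hW : Integrable W P) :
    k.phi μ t m P W =ᵐ[P] fun ω => k.onLaw μ t (condLaw m P W ω) := by
  have hRm : Measurable[m] fun ω => ∫ p, quantile (condLaw m P W ω) p ∂(μ t) :=
    @IsQuantileWeight.measurable_integral_quantile (μ t) hμ Ω m (@condDistrib Ω Ω ℝ _ _ _ mΩ m W id P _) _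
  have hRi := integrable_integral_quantile_condLaw hμ hm hW
  have hmax : Measurable[m.prod inferInstance] fun x : Ω × ℝ =>
      max ((∫ p, quantile (condLaw m P W x.1) p ∂(μ t)) - x.2) 0 :=
    @IsQuantileWeight.measurable_max_integral_quantile_sub (μ t) hμ Ω m
      (@condDistrib Ω Ω ℝ _ _ _ mΩ m W id P _) _
  have hmaxi : Integrable (fun ω => max ((∫ p, quantile (condLaw m P W ω) p ∂(μ t)) - W ω) 0) P :=
    (hRi.sub hW).pos_part
  cases k with
  | costOfCapital η =>
    have h := condExp_prod_ae_eq_integral_condLaw hm hW.1.aemeasurable (f := fun x => x.2)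
      (@measurable_snd Ω ℝ m _) hW
    filter_upwards [h] with ω hω
    simp only [phi, onLaw, condRisk_neg_eq]
    rw [hω]
  | limitedLiability η =>
    have h := condExp_prod_ae_eq_integral_condLaw hm hW.1.aemeasurable hmax hmaxi
    filter_upwards [h] with ω hω
    simp only [phi, onLaw, condRisk_neg_eq]
    rw [hω]
  | powerUtility β =>
    obtain ⟨hβ0, hβ1⟩ : 0 < β t ∧ β t ≤ 1 := hk t ht
    have h := condExp_prod_ae_eq_integral_condLaw hm hW.1.aemeasurable
      (@measurable_rpow_const_comp _ (m.prod _) _ hmax (β t))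
      (integrable_rpow_of_integrable hβ0 hβ1 (fun ω => le_max_right _ _) hmaxi)
    filter_upwards [h] with ω hω
    simp only [phi, onLaw, condRisk_neg_eq]
    rw [hω]

theorem ValuationRule.integrable_onLaw_condLaw (hk : k.Admissible T) (ht : t < T)
    (hμ : IsQuantileWeight (μ t)) {Ω : Type*} {m : MeasurableSpace Ω}
    {mΩ : MeasurableSpace Ω} {P : Measure Ω} [IsFiniteMeasure P] (hm : m ≤ mΩ)
    {W : Ω → ℝ} (hW : Integrable W P) :
    Integrable (fun ω => k.onLaw μ t (condLaw m P W ω)) P := by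
  have hmeas : Measurable[m] fun ω => k.onLaw μ t (condLaw m P W ω) :=
    @ValuationRule.measurable_onLaw μ t hμ k Ω m (@condDistrib Ω Ω ℝ _ _ _ mΩ m W id P _) _
  obtain ⟨K, hK0, hK⟩ := k.exists_abs_onLaw_le hk ht hμ
  have h := condExp_prod_ae_eq_integral_condLaw hm hW.1.aemeasurable (f := fun x => |x.2|)
    (@measurable_abs_snd Ω m) hW.abs
  refine Integrable.mono' ((integrable_condExp (m := m) (f := fun ω => |W ω|)).const_mul K)
    (hmeas.mono hm le_rfl).aestronglyMeasurable ?_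
  filter_upwards [h, integrable_condLaw_ae hm hW] with ω h1 h2
  rw [h1]
  exact hK _ h2

end Conditional

/-! ### Path and history spaces, and induction backward from the horizon. -/

section Path

/-- Paths of the process `(X, Y)`. -/
abbrev PathSpace (T d : ℕ) : Type := Fin T → ℝ × (Fin d → ℝ)

/-- Pasts of the process `(X, Y)` up to and including time `t`. -/
abbrev HistSpace (T d t : ℕ) : Type := {i : Fin T // (i : ℕ) < t} → ℝ × (Fin d → ℝ)

theorem continuous_upTo {T : ℕ} {E : Type*} [TopologicalSpace E] (t : ℕ) :
    Continuous (upTo t : (Fin T → E) → _) :=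
  continuous_pi fun _ => continuous_apply _

theorem measurable_upTo {T : ℕ} {E : Type*} [MeasurableSpace E] (t : ℕ) :
    Measurable (upTo t : (Fin T → E) → _) :=
  measurable_pi_lambda _ fun _ => measurable_pi_apply _

theorem measurable_joint {Ω : Type*} [MeasurableSpace Ω] {T d : ℕ} {X : Ω → Fin T → ℝ}
    {Y : Ω → Fin T → Fin d → ℝ} (hX : Measurable X) (hY : Measurable Y) :
    Measurable (joint X Y) :=
  measurable_pi_lambda _ fun i => ((measurable_pi_apply i).comp hX).prodMk
    ((measurable_pi_apply i).comp hY)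

theorem histSigma_le {Ω : Type*} [mΩ : MeasurableSpace Ω] {T d : ℕ} {X : Ω → Fin T → ℝ}
    {Y : Ω → Fin T → Fin d → ℝ} (hX : Measurable X) (hY : Measurable Y) (t : ℕ) :
    histSigma X Y t ≤ mΩ :=
  ((measurable_upTo t).comp (measurable_joint hX hY)).comap_le

@[elab_as_elim]
theorem backward_induction {T : ℕ} {p : ℕ → Prop} (h0 : ∀ t, T ≤ t → p t)
    (hs : ∀ t < T, p (t + 1) → p t) (t : ℕ) : p t := by
  by_cases h : T ≤ t
  · exact h0 t h
  · exact hs t (not_le.1 h) (backward_induction h0 hs (t + 1))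
termination_by T - t

end Path

/-! ### The value process as a pointwise function of the past. -/

section KernelValue

variable {T d : ℕ} {k : ValuationRule} {μ : ℕ → Measure ℝ}

/-- The value at time `t` as a function of the past, computed from conditional distributions. -/
noncomputable def kernelValue (k : ValuationRule) (μ : ℕ → Measure ℝ)
    (κ : ∀ t : ℕ, Kernel (HistSpace T d t) (PathSpace T d)) (t : ℕ) (z : HistSpace T d t) : ℝ :=
  if h : t < T then
    k.onLaw μ t ((κ t z).map fun z' => (z' ⟨t, h⟩).1 + kernelValue k μ κ (t + 1) (upTo (t + 1) z'))
  else 0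
termination_by T - t

/-- The payoff at time `t + 1` to which the valuation mapping at time `t` is applied. -/
noncomputable def nextPayoff (k : ValuationRule) (μ : ℕ → Measure ℝ)
    (κ : ∀ t : ℕ, Kernel (HistSpace T d t) (PathSpace T d)) {t : ℕ} (h : t < T)
    (z : PathSpace T d) : ℝ :=
  (z ⟨t, h⟩).1 + kernelValue k μ κ (t + 1) (upTo (t + 1) z)

theorem kernelValue_of_lt (κ : ∀ t : ℕ, Kernel (HistSpace T d t) (PathSpace T d)) {t : ℕ}
    (h : t < T) (z : HistSpace T d t) :
    kernelValue k μ κ t z = k.onLaw μ t ((κ t z).map (nextPayoff k μ κ h)) := by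
  rw [kernelValue, dif_pos h]
  rfl

theorem kernelValue_of_le (κ : ∀ t : ℕ, Kernel (HistSpace T d t) (PathSpace T d)) {t : ℕ}
    (h : T ≤ t) (z : HistSpace T d t) : kernelValue k μ κ t z = 0 := by
  rw [kernelValue, dif_neg h.not_gt]

theorem measurable_nextPayoff_of_measurable {κ : ∀ t : ℕ, Kernel (HistSpace T d t) (PathSpace T d)}
    {t : ℕ} (h : t < T) (hm : Measurable (kernelValue k μ κ (t + 1))) :
    Measurable (nextPayoff k μ κ h) :=
  (measurable_fst.comp (measurable_pi_apply _)).add (hm.comp (measurable_upTo _))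

theorem measurable_kernelValue (hμ : ∀ t < T, IsQuantileWeight (μ t))
    (κ : ∀ t : ℕ, Kernel (HistSpace T d t) (PathSpace T d)) [∀ t, IsMarkovKernel (κ t)] (t : ℕ) :
    Measurable (kernelValue k μ κ t) := by
  refine backward_induction (T := T) (p := fun t => Measurable (kernelValue k μ κ t))
    (fun t ht => ?_) (fun t ht ih => ?_) t
  · convert measurable_const (a := (0 : ℝ)) using 1
    exact funext fun z => kernelValue_of_le κ ht z
  · have hm := measurable_nextPayoff_of_measurable ht ih
    have := Kernel.IsMarkovKernel.map (κ t) hm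
    convert k.measurable_onLaw (hμ t ht) ((κ t).map (nextPayoff k μ κ ht)) using 1
    funext z
    rw [kernelValue_of_lt κ ht, Kernel.map_apply _ hm]

theorem measurable_nextPayoff (hμ : ∀ t < T, IsQuantileWeight (μ t))
    (κ : ∀ t : ℕ, Kernel (HistSpace T d t) (PathSpace T d)) [∀ t, IsMarkovKernel (κ t)] {t : ℕ}
    (h : t < T) : Measurable (nextPayoff k μ κ h) :=
  measurable_nextPayoff_of_measurable h (measurable_kernelValue hμ κ _)

/-- Conditioning depends only on the generated σ-algebra: each measurable set of `γ` is a preimage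
under `g`, so the disintegration may be checked on rectangles. It links kernels on histories to
`condLaw`, which conditions on the identity map. -/
theorem HasCondDistrib.comap_of_eq_comap {Ω α γ 𝓨 : Type*} [MeasurableSpace Ω]
    [mα : MeasurableSpace α] [mγ : MeasurableSpace γ] [MeasurableSpace 𝓨] {P : Measure Ω}
    [IsProbabilityMeasure P] {W : Ω → 𝓨} {f : Ω → γ} (hf : Measurable f) {g : γ → α}
    (hg : Measurable g) (hγ : mγ = mα.comap g) {η : Kernel α 𝓨} [IsMarkovKernel η]
    (h : HasCondDistrib W (g ∘ f) η P) : HasCondDistrib W f (η.comap g hg) P := by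
  have hW : AEMeasurable W P := h.aemeasurable_snd
  have hpair := hf.aemeasurable.prodMk hW
  have hprob := Measure.isProbabilityMeasure_map hpair
  have hprob' := Measure.isProbabilityMeasure_map (μ := P) hf.aemeasurable
  refine ⟨hpair, Measure.ext_prod fun {s u} hs hu => ?_⟩
  obtain ⟨B, hB, rfl⟩ : MeasurableSet[mα.comap g] s := hγ ▸ hs
  have h1 := congrArg (fun ν => ν (B ×ˢ u)) h.map_eq
  rw [Measure.map_apply_of_aemeasurable h.aemeasurable (hB.prod hu),
    Measure.compProd_apply_prod hB hu, setLIntegral_map hB (Kernel.measurable_coe _ hu)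
      (hg.comp hf)] at h1
  rw [Measure.map_apply_of_aemeasurable hpair (hs.prod hu), Measure.compProd_apply_prod hs hu,
    setLIntegral_map hs (Kernel.measurable_coe _ hu) hf]
  exact h1

theorem condLaw_comap_ae_eq {Ω α : Type*} [mΩ : MeasurableSpace Ω] [mα : MeasurableSpace α]
    {P : Measure Ω} [IsProbabilityMeasure P] {Z : Ω → α} (hZ : Measurable Z) {W : Ω → ℝ}
    {η : Kernel α ℝ} [IsMarkovKernel η] (h : HasCondDistrib W Z η P) :
    ∀ᵐ ω ∂P, condLaw (mα.comap Z) P W ω = η (Z ω) := by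
  have hle : mα.comap Z ≤ mΩ := hZ.comap_le
  have h' := @HasCondDistrib.comap_of_eq_comap Ω α Ω ℝ mΩ mα (mα.comap Z) _ P _ W id
    (measurable_id'' hle) Z (comap_measurable Z) rfl η _ h
  exact condLaw_ae_eq hle h.aemeasurable_snd h'

theorem value_of_lt {Ω : Type*} {mΩ : MeasurableSpace Ω} (P : Measure Ω) [IsFiniteMeasure P]
    (X : Ω → Fin T → ℝ) (Y : Ω → Fin T → Fin d → ℝ) {t : ℕ} (h : t < T) :
    value k μ P X Y t = k.phi μ t (histSigma X Y t) P
      (fun ω => X ω ⟨t, h⟩ + value k μ P X Y (t + 1) ω) := by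
  rw [value, dif_pos h]

theorem value_of_le {Ω : Type*} {mΩ : MeasurableSpace Ω} (P : Measure Ω) [IsFiniteMeasure P]
    (X : Ω → Fin T → ℝ) (Y : Ω → Fin T → Fin d → ℝ) {t : ℕ} (h : T ≤ t) :
    value k μ P X Y t = fun _ => 0 := by
  rw [value, dif_neg h.not_gt]

theorem value_ae_eq_kernelValue (hk : k.Admissible T) (hμ : ∀ t < T, IsQuantileWeight (μ t))
    {Ω : Type*} [MeasurableSpace Ω] (P : Measure Ω) [IsProbabilityMeasure P]
    {X : Ω → Fin T → ℝ} {Y : Ω → Fin T → Fin d → ℝ} (hX : Measurable X) (hY : Measurable Y)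
    (hint : ∀ i, Integrable (fun ω => X ω i) P)
    {κ : ∀ t : ℕ, Kernel (HistSpace T d t) (PathSpace T d)} [∀ t, IsMarkovKernel (κ t)]
    (hκ : ∀ t, HasCondDistrib (joint X Y) (fun ω => upTo t (joint X Y ω)) (κ t) P) (t : ℕ) :
    value k μ P X Y t =ᵐ[P] (fun ω => kernelValue k μ κ t (upTo t (joint X Y ω))) ∧
      Integrable (value k μ P X Y t) P := by
  have hZ := measurable_joint hX hY
  -- Integrability of the value is carried along, since the law representation of the preceding
  -- valuation needs an integrable payoff.
  refine backward_induction (T := T) (p := fun t =>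
    value k μ P X Y t =ᵐ[P] (fun ω => kernelValue k μ κ t (upTo t (joint X Y ω))) ∧
      Integrable (value k μ P X Y t) P) (fun t ht => ?_) (fun t ht ih => ?_) t
  · rw [value_of_le P X Y ht]
    exact ⟨ae_of_all _ fun ω => (kernelValue_of_le κ ht _).symm, integrable_zero _ _ _⟩
  · obtain ⟨ih1, ih2⟩ := ih
    have hm : Measurable (nextPayoff k μ κ ht) := measurable_nextPayoff hμ κ ht
    have hW : Integrable (fun ω => X ω ⟨t, ht⟩ + value k μ P X Y (t + 1) ω) P :=
      (hint _).add ih2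
    have hle := histSigma_le hX hY t
    rw [value_of_lt P X Y ht]
    have hphi := k.phi_ae_eq_onLaw hk ht (hμ t ht) hle hW
    have hWe : (fun ω => X ω ⟨t, ht⟩ + value k μ P X Y (t + 1) ω)
        =ᵐ[P] nextPayoff k μ κ ht ∘ joint X Y := by
      filter_upwards [ih1] with ω hω
      rw [hω]
      rfl
    have hcl : condLaw (histSigma X Y t) P (fun ω => X ω ⟨t, ht⟩ + value k μ P X Y (t + 1) ω)
        = condLaw (histSigma X Y t) P (nextPayoff k μ κ ht ∘ joint X Y) := by
      unfold condLaw
      rw [condDistrib_congr_left hWe]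
    have := Kernel.IsMarkovKernel.map (κ t) hm
    have hclκ : ∀ᵐ ω ∂P, condLaw (histSigma X Y t) P (nextPayoff k μ κ ht ∘ joint X Y) ω
        = ((κ t).map (nextPayoff k μ κ ht)) (upTo t (joint X Y ω)) :=
      condLaw_comap_ae_eq ((measurable_upTo t).comp hZ) ((hκ t).comp_left hm)
    refine ⟨?_, (k.integrable_onLaw_condLaw hk ht (hμ t ht) hle hW).congr hphi.symm⟩
    filter_upwards [hphi, hclκ] with ω h1 h2
    rw [h1, hcl, kernelValue_of_lt κ ht]
    rw [h2, Kernel.map_apply _ hm]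

end KernelValue

/-! ### Sequential limits, the extended continuous mapping theorem, truncated uniform integrability.
-/

section Sequences

/-- The assumption concerns full sequences `y n ∈ S n`, but the filter limit also tests
subsequences. A subsequence with strictly increasing indices becomes a full sequence by filling the
missing indices from a reference sequence converging to `z`. -/
theorem tendsto_prod_inf_principal_of_forall_seq {α β : Type*} [TopologicalSpace α]
    [FirstCountableTopology α] [TopologicalSpace β] {f : ℕ → α → β} {S : ℕ → Set α} {z : α} {b : β}
    (hfill : ∃ y : ℕ → α, (∀ n, y n ∈ S n) ∧ Tendsto y atTop (𝓝 z))
    (h : ∀ y : ℕ → α, (∀ n, y n ∈ S n) → Tendsto y atTop (𝓝 z) →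
      Tendsto (fun n => f n (y n)) atTop (𝓝 b)) :
    Tendsto (fun p : ℕ × α => f p.1 p.2) ((atTop ×ˢ 𝓝 z) ⊓ 𝓟 {p | p.2 ∈ S p.1}) (𝓝 b) := by
  classical
  obtain ⟨y₀, hy₀, hy₀z⟩ := hfill
  refine tendsto_of_seq_tendsto fun x hx => tendsto_of_subseq_tendsto fun ns hns => ?_
  have hx' := hx.comp hns
  rw [tendsto_inf, tendsto_principal, tendsto_prod_iff'] at hx'
  obtain ⟨⟨hx1, hx2⟩, hx3⟩ := hx'
  obtain ⟨N, hN⟩ := eventually_atTop.1 hx3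
  obtain ⟨φ, hφ, hφm⟩ := strictMono_subseq_of_tendsto_atTop (hx1.comp (tendsto_add_atTop_nat N))
  set w : ℕ → ℕ × α := fun j => x (ns (φ j + N)) with hw
  have hwS : ∀ j, (w j).2 ∈ S (w j).1 := fun j => hN _ (Nat.le_add_left _ _)
  have hwm : StrictMono fun j => (w j).1 := hφm
  have hw2 : Tendsto (fun j => (w j).2) atTop (𝓝 z) :=
    hx2.comp ((tendsto_add_atTop_nat N).comp hφ.tendsto_atTop)
  let y : ℕ → α := fun n => if hn : ∃ j, (w j).1 = n then (w hn.choose).2 else y₀ n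
  have hyw : ∀ j, y (w j).1 = (w j).2 := by
    intro j
    have hex : ∃ i, (w i).1 = (w j).1 := ⟨j, rfl⟩
    have : hex.choose = j := hwm.injective hex.choose_spec
    simp only [y, dif_pos hex, this]
  have hyS : ∀ n, y n ∈ S n := by
    intro n
    by_cases hn : ∃ j, (w j).1 = n
    · obtain ⟨j, rfl⟩ := hn
      rw [hyw]
      exact hwS j
    · simp only [y, dif_neg hn]
      exact hy₀ n
  have hyz : Tendsto y atTop (𝓝 z) := by
    refine tendsto_def.2 fun U hU => ?_
    obtain ⟨J, hJ⟩ := eventually_atTop.1 (hw2.eventually hU)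
    filter_upwards [hy₀z.eventually hU, eventually_ge_atTop (w J).1] with n hn1 hn2
    by_cases hn : ∃ j, (w j).1 = n
    · obtain ⟨j, rfl⟩ := hn
      rw [Set.mem_preimage, hyw]
      exact hJ j (hwm.le_iff_le.1 hn2)
    · rw [Set.mem_preimage]
      simp only [y, dif_neg hn]
      exact hn1
  refine ⟨fun j => φ j + N, ?_⟩
  have := (h y hyS hyz).comp hwm.tendsto_atTop
  refine this.congr fun j => ?_
  simp only [Function.comp_apply, hyw]
  rfl

/-- A ball around a support point has positive `Q`-mass, so eventually positive `Qs n`-mass, and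
therefore meets the full-measure set `S n`. -/
theorem exists_seq_mem_tendsto_of_mem_support {α : Type*} [PseudoMetricSpace α] [MeasurableSpace α]
    {Q : Measure α} {Qs : ℕ → Measure α} [∀ n, IsProbabilityMeasure (Qs n)]
    (hopen : ∀ G : Set α, IsOpen G → Q G ≤ liminf (fun n => Qs n G) atTop)
    {S : ℕ → Set α} (hS : ∀ n, ∀ᵐ y ∂(Qs n), y ∈ S n) {z : α} (hz : z ∈ Q.support) :
    ∃ y : ℕ → α, (∀ n, y n ∈ S n) ∧ Tendsto y atTop (𝓝 z) := by
  have hne : ∀ n, (S n).Nonempty := fun n => (hS n).exists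
  -- The distance to `S n` need not be attained, hence the vanishing slack `1 / (n + 1)`.
  have hex : ∀ n, ∃ y ∈ S n, dist z y < Metric.infDist z (S n) + 1 / ((n : ℝ) + 1) := fun n =>
    (Metric.infDist_lt_iff (hne n)).1 (lt_add_of_pos_right _ (by positivity))
  choose y hyS hyd using hex
  refine ⟨y, hyS, ?_⟩
  have hinf : Tendsto (fun n => Metric.infDist z (S n)) atTop (𝓝 0) := by
    rw [Metric.tendsto_atTop']
    intro ε hε
    have hpos := (Measure.mem_support_iff_forall z).1 hz _ (Metric.ball_mem_nhds z hε)
    have hev := eventually_lt_of_lt_liminf (hpos.trans_le (hopen _ Metric.isOpen_ball))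
    obtain ⟨N, hN⟩ := eventually_atTop.1 hev
    refine ⟨N, fun n hn => ?_⟩
    have hn' := hN n hn.le
    obtain ⟨w, hwS, hwb⟩ : ∃ w, w ∈ S n ∧ w ∈ Metric.ball z ε := by
      by_contra hcon
      push Not at hcon
      refine hn'.ne' (measure_mono_null (fun w hw => ?_) (hS n))
      exact fun hwS => hcon w hwS hw
    rw [Real.dist_eq, sub_zero, abs_of_nonneg Metric.infDist_nonneg]
    refine (Metric.infDist_le_dist_of_mem hwS).trans_lt ?_
    rwa [dist_comm]
  have hlim := hinf.add tendsto_one_div_add_atTop_nhds_zero_nat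
  rw [add_zero] at hlim
  rw [tendsto_iff_dist_tendsto_zero]
  exact squeeze_zero (fun n => dist_nonneg) (fun n => by rw [dist_comm]; exact (hyd n).le) hlim

/-- Extended continuous mapping theorem, in the open-set form of weak convergence. -/
theorem le_liminf_measure_preimage {α β : Type*} [TopologicalSpace α] [MeasurableSpace α]
    [TopologicalSpace β] {Q : Measure α} {Qs : ℕ → Measure α}
    (hopen : ∀ G : Set α, IsOpen G → Q G ≤ liminf (fun n => Qs n G) atTop)
    {h : α → β} {hs : ℕ → α → β} {S : ℕ → Set α} {S' : Set α}
    (hS : ∀ n, ∀ᵐ y ∂(Qs n), y ∈ S n) (hS' : ∀ᵐ y ∂Q, y ∈ S')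
    (hlim : ∀ y ∈ S', Tendsto (fun p : ℕ × α => hs p.1 p.2)
      ((atTop ×ˢ 𝓝 y) ⊓ 𝓟 {p | p.2 ∈ S p.1}) (𝓝 (h y)))
    {G : Set β} (hG : IsOpen G) :
    Q (h ⁻¹' G) ≤ liminf (fun n => Qs n (hs n ⁻¹' G)) atTop := by
  -- These open sets increase with `k` and exhaust `h ⁻¹' G` up to a `Q`-null set. Each of them is,
  -- for `n ≥ k`, contained in `hs n ⁻¹' G` up to a `Qs n`-null set, so the open-set inequality
  -- applies to it.
  let A : ℕ → Set α := fun k => interior {y | ∀ n, k ≤ n → y ∈ S n → hs n y ∈ G}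
  have hA : Monotone A := fun k l hkl =>
    interior_mono fun y hy n hn => hy n (hkl.trans hn)
  have hsub : ∀ y ∈ S', h y ∈ G → y ∈ ⋃ k, A k := by
    intro y hy hyG
    have hev := (hlim y hy).eventually (hG.mem_nhds hyG)
    rw [eventually_inf_principal, eventually_prod_iff] at hev
    obtain ⟨pa, hpa, pb, hpb, hp⟩ := hev
    obtain ⟨k, hk⟩ := eventually_atTop.1 hpa
    refine Set.mem_iUnion.2 ⟨k, mem_interior_iff_mem_nhds.2 ?_⟩
    filter_upwards [hpb] with w hw n hn hwS
    exact hp (hk n hn) hw hwS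
  calc Q (h ⁻¹' G) ≤ Q (⋃ k, A k) := by
        refine measure_mono_ae ?_
        filter_upwards [hS'] with y hy hyG
        exact hsub y hy hyG
    _ = ⨆ k, Q (A k) := hA.measure_iUnion
    _ ≤ _ := by
        refine iSup_le fun k => (hopen _ isOpen_interior).trans ?_
        refine liminf_le_liminf ?_
        filter_upwards [eventually_ge_atTop k] with n hn
        refine measure_mono_ae ?_
        filter_upwards [hS n] with y hy hyA
        exact interior_subset hyA n hn hy

/-- For `r ≥ 0`, the positive part `(f - r)⁺` is at most `f` on `{f > r}`. Unlike the indicator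
form, the truncated form passes well through sums and conditional means. -/
theorem exists_lintegral_ofReal_sub_le {α : Type*} [MeasurableSpace α] {f : α → ℝ}
    (hf : Measurable f) (hf0 : ∀ x, 0 ≤ f x) {Qs : ℕ → Measure α}
    (hUI : UnifIntegrableLaws fun n => (Qs n).map f) {ε : ℝ≥0∞} (hε : 0 < ε) :
    ∃ r : ℝ, 0 ≤ r ∧ ∀ n, ∫⁻ x, ENNReal.ofReal (f x - r) ∂(Qs n) ≤ ε := by
  have hev := (ENNReal.tendsto_nhds_zero.1 hUI ε hε).and (eventually_ge_atTop 0)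
  obtain ⟨r, hr, hr0⟩ := hev.exists
  refine ⟨r, hr0, fun n => ?_⟩
  refine le_trans ?_ ((le_iSup (fun n => ∫⁻ x in {x : ℝ | r < |x|}, ENNReal.ofReal |x| ∂((Qs n).map f))
    n).trans hr)
  have hset : MeasurableSet {x : ℝ | r < |x|} := measurableSet_lt measurable_const (by fun_prop)
  rw [← lintegral_indicator hset, lintegral_map (Measurable.indicator (by fun_prop) hset) hf]
  refine lintegral_mono fun x => ?_
  by_cases hx : r < f x
  · rw [Set.indicator_of_mem (by simpa [abs_of_nonneg (hf0 x)] using hx), abs_of_nonneg (hf0 x)]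
    exact ENNReal.ofReal_le_ofReal (by linarith)
  · rw [ENNReal.ofReal_of_nonpos (by linarith)]
    exact zero_le

end Sequences

/-! ### Consistency of the conditional kernels over successive times. -/

section Tower

variable {T d : ℕ}

theorem hasCondDistrib_comp_upTo {Ω : Type*} [MeasurableSpace Ω] {P : Measure Ω}
    [IsProbabilityMeasure P] {Z : Ω → PathSpace T d} (hZ : Measurable Z)
    {κ : ∀ t : ℕ, Kernel (HistSpace T d t) (PathSpace T d)} [∀ t, IsMarkovKernel (κ t)]
    (hκ : ∀ t, HasCondDistrib Z (fun ω => upTo t (Z ω)) (κ t) P) (t : ℕ) :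
    HasCondDistrib Z (fun ω => upTo t (Z ω))
      (((κ (t + 1)).comap (upTo (t + 1)) (measurable_upTo _)) ∘ₖ κ t) P := by
  have hZt : ∀ t, Measurable fun ω => upTo t (Z ω) := fun t => (measurable_upTo t).comp hZ
  let pr : HistSpace T d (t + 1) → HistSpace T d t := fun z i => z ⟨i.1, i.2.trans t.lt_succ_self⟩
  have hpr : Measurable pr := measurable_pi_lambda _ fun _ => measurable_pi_apply _
  refine ⟨((hZt t).prodMk hZ).aemeasurable, Measure.ext_of_lintegral _ fun f hf => ?_⟩
  have hG : Measurable fun y : HistSpace T d t × PathSpace T d =>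
      ∫⁻ z, f (y.1, z) ∂(κ (t + 1) (upTo (t + 1) y.2)) :=
    Measurable.lintegral_kernel_prod_right' (κ := (κ (t + 1)).comap
        (fun y : HistSpace T d t × PathSpace T d => upTo (t + 1) y.2)
        ((measurable_upTo _).comp measurable_snd))
      (f := fun p => f (p.1.1, p.2)) (by fun_prop)
  calc ∫⁻ y, f y ∂(P.map fun ω => (upTo t (Z ω), Z ω))
      = ∫⁻ ω, f (pr (upTo (t + 1) (Z ω)), Z ω) ∂P := by
        rw [lintegral_map hf ((hZt t).prodMk hZ)]
        rfl
    _ = ∫⁻ y, f (pr y.1, y.2) ∂(P.map fun ω => (upTo (t + 1) (Z ω), Z ω)) := by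
        rw [lintegral_map (by fun_prop) ((hZt (t + 1)).prodMk hZ)]
    _ = ∫⁻ z, ∫⁻ y, f (pr z, y) ∂(κ (t + 1) z) ∂(P.map fun ω => upTo (t + 1) (Z ω)) := by
        rw [(hκ (t + 1)).map_eq, Measure.lintegral_compProd (by fun_prop)]
    _ = ∫⁻ ω, ∫⁻ y, f (upTo t (Z ω), y) ∂(κ (t + 1) (upTo (t + 1) (Z ω))) ∂P := by
        rw [lintegral_map (Measurable.lintegral_kernel_prod_right' (κ := κ (t + 1))
          (f := fun p => f (pr p.1, p.2)) (by fun_prop)) (hZt (t + 1))]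
        rfl
    _ = ∫⁻ y, ∫⁻ z, f (y.1, z) ∂(κ (t + 1) (upTo (t + 1) y.2))
          ∂(P.map fun ω => (upTo t (Z ω), Z ω)) := by
        rw [lintegral_map hG ((hZt t).prodMk hZ)]
    _ = _ := by
        rw [(hκ t).map_eq, Measure.lintegral_compProd hG, Measure.lintegral_compProd hf]
        refine lintegral_congr fun z => ?_
        rw [Kernel.lintegral_comp _ _ _ (by fun_prop)]
        rfl

/-- Both `κ t` and the composition through time `t + 1` are conditional distributions given the past
at `t`; uniqueness identifies them off one null set, the same for all `f`. -/
theorem lintegral_kernel_tower_ae {Ω : Type*} [MeasurableSpace Ω] {P : Measure Ω}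
    [IsProbabilityMeasure P] {Z : Ω → PathSpace T d} (hZ : Measurable Z)
    {κ : ∀ t : ℕ, Kernel (HistSpace T d t) (PathSpace T d)} [∀ t, IsMarkovKernel (κ t)]
    (hκ : ∀ t, HasCondDistrib Z (fun ω => upTo t (Z ω)) (κ t) P) (t : ℕ) :
    ∀ᵐ z ∂(P.map fun ω => upTo t (Z ω)), ∀ f : PathSpace T d → ℝ≥0∞, Measurable f →
      ∫⁻ z', ∫⁻ y, f y ∂(κ (t + 1) (upTo (t + 1) z')) ∂(κ t z) = ∫⁻ y, f y ∂(κ t z) := by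
  have h1 := condDistrib_ae_eq_of_measure_eq_compProd _ hZ.aemeasurable (hκ t).map_eq
  have h2 := condDistrib_ae_eq_of_measure_eq_compProd _ hZ.aemeasurable
    (hasCondDistrib_comp_upTo hZ hκ t).map_eq
  filter_upwards [h1, h2] with z hz1 hz2 f hf
  conv_rhs => rw [← hz1, hz2]
  rw [Kernel.lintegral_comp _ _ _ hf]
  rfl

theorem ae_ae_upTo_mem {Ω : Type*} [MeasurableSpace Ω] {P : Measure Ω}
    [IsProbabilityMeasure P] {Z : Ω → PathSpace T d} (hZ : Measurable Z)
    {κ : ∀ t : ℕ, Kernel (HistSpace T d t) (PathSpace T d)} [∀ t, IsMarkovKernel (κ t)]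
    (hκ : ∀ t, HasCondDistrib Z (fun ω => upTo t (Z ω)) (κ t) P) (t : ℕ)
    {S : Set (HistSpace T d (t + 1))} (hS : ∀ᵐ z ∂(P.map fun ω => upTo (t + 1) (Z ω)), z ∈ S) :
    ∀ᵐ z ∂(P.map fun ω => upTo t (Z ω)), ∀ᵐ z' ∂(κ t z), upTo (t + 1) z' ∈ S := by
  have hZt : ∀ t, Measurable fun ω => upTo t (Z ω) := fun t => (measurable_upTo t).comp hZ
  refine Measure.ae_ae_of_ae_compProd
    (p := fun y : HistSpace T d t × PathSpace T d => upTo (t + 1) y.2 ∈ S) ?_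
  rw [← (hκ t).map_eq]
  -- `S` need not be measurable, so its complement is enlarged to a measurable null set.
  obtain ⟨N, hSN, hNm, hN0⟩ := exists_measurable_superset_of_null (ae_iff.1 hS)
  rw [Measure.map_apply (hZt _) hNm] at hN0
  have hN : ∀ᵐ y ∂(P.map fun ω => (upTo t (Z ω), Z ω)), upTo (t + 1) y.2 ∉ N := by
    have hm : MeasurableSet {y : HistSpace T d t × PathSpace T d | upTo (t + 1) y.2 ∉ N} :=
      ((measurable_upTo (t + 1)).comp measurable_snd) hNm.compl
    rw [ae_map_iff ((hZt t).prodMk hZ).aemeasurable hm]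
    exact measure_eq_zero_iff_ae_notMem.1 hN0
  filter_upwards [hN] with y hy
  by_contra hcon
  exact hy (hSN hcon)

/-- The space of empty pasts is one point, so this holds at every `z`, not merely almost everywhere.
-/
theorem kernel_zero_eq_map {Ω : Type*} [MeasurableSpace Ω] {P : Measure Ω}
    [IsProbabilityMeasure P] {Z : Ω → PathSpace T d} (hZ : Measurable Z)
    {κ : Kernel (HistSpace T d 0) (PathSpace T d)} [IsMarkovKernel κ]
    (hκ : HasCondDistrib Z (fun ω => upTo 0 (Z ω)) κ P) (z : HistSpace T d 0) :
    κ z = P.map Z := by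
  have : IsEmpty {i : Fin T // (i : ℕ) < 0} := ⟨fun i => Nat.not_lt_zero _ i.2⟩
  have hconst : (fun ω => upTo 0 (Z ω)) = fun _ => z := funext fun _ => Subsingleton.elim _ _
  have h1 := congrArg Measure.snd hκ.map_eq
  have h0 : Measurable fun ω => upTo 0 (Z ω) := (measurable_upTo 0).comp hZ
  rw [Measure.snd_map_prodMk h0, Measure.snd_compProd, hconst] at h1
  rw [h1]
  simp [Measure.dirac_bind (Kernel.measurable κ)]

end Tower

/-! ### The cashflow norm dominates each cashflow. -/

section CashNorm

variable {T d : ℕ}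

theorem cashNorm_nonneg (z : PathSpace T d) : 0 ≤ cashNorm z := Real.sqrt_nonneg _

theorem abs_fst_le_cashNorm (z : PathSpace T d) (i : Fin T) : |(z i).1| ≤ cashNorm z := by
  rw [← Real.sqrt_sq_eq_abs]
  exact Real.sqrt_le_sqrt (Finset.single_le_sum (f := fun i => (z i).1 ^ 2)
    (fun i _ => sq_nonneg _) (Finset.mem_univ i))

theorem measurable_cashNorm : Measurable (cashNorm : PathSpace T d → ℝ) := by
  have : Continuous (cashNorm : PathSpace T d → ℝ) := by
    unfold cashNorm euclNorm
    fun_prop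
  exact this.measurable

end CashNorm

/-! ### Domination of values by conditional means of the cashflow norm. -/

section Domination

variable {T d : ℕ} {k : ValuationRule} {μ : ℕ → Measure ℝ}
  {κ : ∀ t : ℕ, Kernel (HistSpace T d t) (PathSpace T d)} [∀ t, IsMarkovKernel (κ t)]

/-- The next payoff is at most the norm plus `C` times its conditional mean one step later. The
threshold splits as `r + C r`, the second piece moves inside the conditional mean, and the tower
property brings both back to `κ t z`. With `r = 0` it bounds the first moment; for large `r` it
transfers uniform integrability. -/
theorem lintegral_nextPayoff_sub_le {t : ℕ} (ht : t < T) {C : ℝ≥0}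
    {S : Set (HistSpace T d (t + 1))}
    (hS : ∀ y ∈ S, ENNReal.ofReal |kernelValue k μ κ (t + 1) y|
      ≤ C * ∫⁻ z, ENNReal.ofReal (cashNorm z) ∂(κ (t + 1) y))
    {z : HistSpace T d t} (hz : ∀ᵐ z' ∂(κ t z), upTo (t + 1) z' ∈ S)
    (htower : ∀ f : PathSpace T d → ℝ≥0∞, Measurable f →
      ∫⁻ z', ∫⁻ y, f y ∂(κ (t + 1) (upTo (t + 1) z')) ∂(κ t z) = ∫⁻ y, f y ∂(κ t z))
    {r : ℝ} (hr : 0 ≤ r) :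
    ∫⁻ z', ENNReal.ofReal (|nextPayoff k μ κ ht z'| - (1 + C) * r) ∂(κ t z)
      ≤ (1 + C) * ∫⁻ z', ENNReal.ofReal (cashNorm z' - r) ∂(κ t z) := by
  have hc := measurable_cashNorm (T := T) (d := d)
  have hm : Measurable fun z' : PathSpace T d => ENNReal.ofReal (cashNorm z' - r) := by fun_prop
  calc ∫⁻ z', ENNReal.ofReal (|nextPayoff k μ κ ht z'| - (1 + C) * r) ∂(κ t z)
      ≤ ∫⁻ z', (ENNReal.ofReal (cashNorm z' - r) +
          C * ∫⁻ y, ENNReal.ofReal (cashNorm y - r) ∂(κ (t + 1) (upTo (t + 1) z'))) ∂(κ t z) := by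
        refine lintegral_mono_ae ?_
        filter_upwards [hz] with z' hz'
        have h1 : |nextPayoff k μ κ ht z'| - (1 + C) * r ≤ (cashNorm z' - r)
            + (|kernelValue k μ κ (t + 1) (upTo (t + 1) z')| - C * r) := by
          have h2 := abs_add_le (z' ⟨t, ht⟩).1 (kernelValue k μ κ (t + 1) (upTo (t + 1) z'))
          have h3 := abs_fst_le_cashNorm z' ⟨t, ht⟩
          unfold nextPayoff
          linarith
        refine (ENNReal.ofReal_le_ofReal h1).trans (ENNReal.ofReal_add_le.trans ?_)
        gcongr
        rw [ENNReal.ofReal_sub _ (by positivity), ENNReal.ofReal_mul (by positivity),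
          ENNReal.ofReal_coe_nnreal]
        calc _ ≤ C * (∫⁻ y, ENNReal.ofReal (cashNorm y) ∂(κ (t + 1) (upTo (t + 1) z')))
              - C * ENNReal.ofReal r := tsub_le_tsub_right (hS _ hz') _
          _ = C * ((∫⁻ y, ENNReal.ofReal (cashNorm y) ∂(κ (t + 1) (upTo (t + 1) z')))
              - ENNReal.ofReal r) := by
              rw [ENNReal.mul_sub]
              simp
          _ ≤ _ := by
              gcongr
              have h4 := lintegral_sub_le' (μ := κ (t + 1) (upTo (t + 1) z'))
                (fun y => ENNReal.ofReal r) (fun y => ENNReal.ofReal (cashNorm y)) (by fun_prop)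
              simp only [lintegral_const, measure_univ, mul_one] at h4
              refine h4.trans_eq (lintegral_congr fun y => ?_)
              rw [ENNReal.ofReal_sub _ hr]
    _ = _ := by
        rw [lintegral_add_left hm, lintegral_const_mul' _ _ ENNReal.coe_ne_top, htower _ hm]
        ring

theorem ofReal_abs_kernelValue_le (hμ : ∀ t < T, IsQuantileWeight (μ t)) {t : ℕ} (ht : t < T)
    {C K : ℝ≥0} (hK : ∀ (ν : Measure ℝ) [IsProbabilityMeasure ν], Integrable (fun x => x) ν →
      |k.onLaw μ t ν| ≤ K * ∫ x, |x| ∂ν)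
    {S : Set (HistSpace T d (t + 1))}
    (hS : ∀ y ∈ S, ENNReal.ofReal |kernelValue k μ κ (t + 1) y|
      ≤ C * ∫⁻ z, ENNReal.ofReal (cashNorm z) ∂(κ (t + 1) y))
    {z : HistSpace T d t} (hz : ∀ᵐ z' ∂(κ t z), upTo (t + 1) z' ∈ S)
    (htower : ∀ f : PathSpace T d → ℝ≥0∞, Measurable f →
      ∫⁻ z', ∫⁻ y, f y ∂(κ (t + 1) (upTo (t + 1) z')) ∂(κ t z) = ∫⁻ y, f y ∂(κ t z)) :
    ENNReal.ofReal |kernelValue k μ κ t z|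
      ≤ ((K + 1) * (1 + C) : ℝ≥0) * ∫⁻ z', ENNReal.ofReal (cashNorm z') ∂(κ t z) := by
  -- An infinite moment leaves nothing to prove, provided the constant is nonzero: this is why it
  -- contains `K + 1` rather than `K`.
  by_cases htop : ∫⁻ z', ENNReal.ofReal (cashNorm z') ∂(κ t z) = ∞
  · rw [htop, ENNReal.mul_top (ENNReal.coe_ne_zero.2 (by positivity))]
    exact le_top
  have hm : Measurable (nextPayoff k μ κ ht) := measurable_nextPayoff hμ κ ht
  have h0 := lintegral_nextPayoff_sub_le ht hS hz htower le_rfl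
  simp only [mul_zero, sub_zero] at h0
  have hmap : ∫⁻ x, ENNReal.ofReal |x| ∂((κ t z).map (nextPayoff k μ κ ht))
      = ∫⁻ z', ENNReal.ofReal |nextPayoff k μ κ ht z'| ∂(κ t z) :=
    lintegral_map (by fun_prop) hm
  have hfin : ∫⁻ x, ENNReal.ofReal |x| ∂((κ t z).map (nextPayoff k μ κ ht)) ≠ ∞ := by
    rw [hmap]
    exact (h0.trans_lt (ENNReal.mul_lt_top (by finiteness) (Ne.lt_top htop))).ne
  have hprob : IsProbabilityMeasure ((κ t z).map (nextPayoff k μ κ ht)) :=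
    Measure.isProbabilityMeasure_map hm.aemeasurable
  have hint : Integrable (fun x => x) ((κ t z).map (nextPayoff k μ κ ht)) :=
    integrable_of_lintegral_ofReal_abs_sub_ne_top (r := 0) (by simpa using hfin)
  rw [kernelValue_of_lt κ ht]
  calc _ ≤ ENNReal.ofReal (K * ∫ x, |x| ∂((κ t z).map (nextPayoff k μ κ ht))) :=
        ENNReal.ofReal_le_ofReal (hK _ hint)
    _ = K * ∫⁻ z', ENNReal.ofReal |nextPayoff k μ κ ht z'| ∂(κ t z) := by
        rw [ENNReal.ofReal_mul K.coe_nonneg, ofReal_integral_eq_lintegral_ofReal hint.abs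
          (ae_of_all _ fun x => abs_nonneg x), hmap]
        simp
    _ ≤ K * ((1 + C) * ∫⁻ z', ENNReal.ofReal (cashNorm z') ∂(κ t z)) := by gcongr
    _ ≤ _ := by
        rw [ENNReal.coe_mul, ENNReal.coe_add, ENNReal.coe_add, ENNReal.coe_one, mul_assoc]
        gcongr
        exact le_self_add

end Domination

/-! ### Backward induction for the convergence of value functions. -/

section Convergence

variable {T d : ℕ} {k : ValuationRule} {μ : ℕ → Measure ℝ}

/-- One backward step: the value functions converge along sequences on which the conditional
distributions converge. -/
theorem tendsto_kernelValue_of_tendsto (hk : k.Admissible T)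
    (hμ : ∀ t < T, IsQuantileWeight (μ t))
    {κ : ∀ t : ℕ, Kernel (HistSpace T d t) (PathSpace T d)} [∀ t, IsMarkovKernel (κ t)]
    {κn : ∀ _n t : ℕ, Kernel (HistSpace T d t) (PathSpace T d)} [∀ n t, IsMarkovKernel (κn n t)]
    {t : ℕ} (ht : t < T) {C : ℝ≥0} {S : ℕ → Set (HistSpace T d (t + 1))}
    {S' : Set (HistSpace T d (t + 1))}
    (hS : ∀ n, ∀ y ∈ S n, ENNReal.ofReal |kernelValue k μ (κn n) (t + 1) y|
      ≤ C * ∫⁻ z, ENNReal.ofReal (cashNorm z) ∂(κn n (t + 1) y))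
    (hlim : ∀ y ∈ S', Tendsto (fun p : ℕ × HistSpace T d (t + 1) =>
        kernelValue k μ (κn p.1) (t + 1) p.2)
      ((atTop ×ˢ 𝓝 y) ⊓ 𝓟 {p | p.2 ∈ S p.1}) (𝓝 (kernelValue k μ κ (t + 1) y)))
    {zn : ℕ → HistSpace T d t} {z : HistSpace T d t}
    (hzn : ∀ n, ∀ᵐ z' ∂(κn n t (zn n)), upTo (t + 1) z' ∈ S n)
    (htower : ∀ n, ∀ f : PathSpace T d → ℝ≥0∞, Measurable f →
      ∫⁻ z', ∫⁻ y, f y ∂(κn n (t + 1) (upTo (t + 1) z')) ∂(κn n t (zn n))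
        = ∫⁻ y, f y ∂(κn n t (zn n)))
    (hz : ∀ᵐ z' ∂(κ t z), upTo (t + 1) z' ∈ S')
    (hgauss : ∃ m v, (κ t z).map (nextPayoff k μ κ ht) = gaussianReal m v)
    (hopen : ∀ G : Set (PathSpace T d), IsOpen G →
      κ t z G ≤ liminf (fun n => κn n t (zn n) G) atTop)
    (hUI : UnifIntegrableLaws fun n => (κn n t (zn n)).map cashNorm) :
    Tendsto (fun n => kernelValue k μ (κn n) t (zn n)) atTop (𝓝 (kernelValue k μ κ t z)) := by
  have hmn : ∀ n, Measurable (nextPayoff k μ (κn n) ht) := fun n => measurable_nextPayoff hμ _ ht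
  have hm : Measurable (nextPayoff k μ κ ht) := measurable_nextPayoff hμ _ ht
  have hprobn : ∀ n, IsProbabilityMeasure ((κn n t (zn n)).map (nextPayoff k μ (κn n) ht)) :=
    fun n => Measure.isProbabilityMeasure_map (hmn n).aemeasurable
  simp only [kernelValue_of_lt _ ht]
  obtain ⟨m, v, hmv⟩ := hgauss
  have hopen' : ∀ G : Set ℝ, IsOpen G → (κ t z).map (nextPayoff k μ κ ht) G
      ≤ liminf (fun n => (κn n t (zn n)).map (nextPayoff k μ (κn n) ht) G) atTop := by
    intro G hG
    rw [Measure.map_apply hm hG.measurableSet]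
    simp_rw [fun n => Measure.map_apply (μ := κn n t (zn n)) (hmn n) hG.measurableSet]
    -- The payoff functions vary with `n` and converge only along paths whose history lies in `S n`;
    -- these carry full mass under `κn n t (zn n)`.
    refine le_liminf_measure_preimage hopen (S := fun n => upTo (t + 1) ⁻¹' S n)
      (S' := upTo (t + 1) ⁻¹' S') hzn hz (fun y hy => ?_) hG
    have hmap : Tendsto (fun p : ℕ × PathSpace T d => (p.1, upTo (t + 1) p.2))
        ((atTop ×ˢ 𝓝 y) ⊓ 𝓟 {p | p.2 ∈ upTo (t + 1) ⁻¹' S p.1})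
        ((atTop ×ˢ 𝓝 (upTo (t + 1) y)) ⊓ 𝓟 {p | p.2 ∈ S p.1}) := by
      refine Tendsto.inf (tendsto_id.prodMap ((continuous_upTo (t + 1)).tendsto y)) ?_
      exact tendsto_principal_principal.2 fun p hp => hp
    refine Tendsto.add ?_ ((hlim _ hy).comp hmap)
    have hcont : Continuous fun w : PathSpace T d => (w ⟨t, ht⟩).1 := by fun_prop
    exact (hcont.tendsto y).comp (tendsto_snd.mono_left inf_le_left)
  have hUI' : ∀ ε : ℝ≥0∞, 0 < ε → ∃ r : ℝ, ∀ n, ∫⁻ x, ENNReal.ofReal (|x| - r)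
      ∂((κn n t (zn n)).map (nextPayoff k μ (κn n) ht)) ≤ ε := by
    intro ε hε
    have hC0 : (1 + C : ℝ≥0∞) ≠ 0 := by positivity
    obtain ⟨r, hr0, hr⟩ := exists_lintegral_ofReal_sub_le measurable_cashNorm cashNorm_nonneg hUI
      (ENNReal.div_pos hε.ne' (by finiteness : (1 + C : ℝ≥0∞) ≠ ∞))
    refine ⟨(1 + C) * r, fun n => ?_⟩
    rw [lintegral_map (by fun_prop) (hmn n)]
    refine (lintegral_nextPayoff_sub_le ht (hS n) (hzn n) (htower n) hr0).trans ?_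
    refine (mul_le_mul_right (hr n) _).trans_eq ?_
    exact ENNReal.mul_div_cancel hC0 (by finiteness)
  rw [hmv] at hopen' ⊢
  exact k.tendsto_onLaw hk ht (hμ t ht) ((memLp_id_gaussianReal 1).integrable (by simp))
    (fun p hp y hy => lt_measureReal_Iio_of_quantile_lt_gaussianReal m v hp hy) hopen' hUI'

variable {Ω : Type*} [MeasurableSpace Ω] {P : Measure Ω} [IsProbabilityMeasure P]
  {Ωn : ℕ → Type*} [∀ n, MeasurableSpace (Ωn n)] {Pn : ∀ n, Measure (Ωn n)}
  [∀ n, IsProbabilityMeasure (Pn n)]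

/-- The limit is joint in `n` and the past, restricted to good sets of full measure: at the
preceding time the past is random, and the extended continuous mapping theorem needs this joint
form. The constant `C` does not depend on `n`. -/
theorem tendsto_kernelValue (hk : k.Admissible T) (hμ : ∀ t < T, IsQuantileWeight (μ t))
    {Z : Ω → PathSpace T d} (hZ : Measurable Z) {Zn : ∀ n, Ωn n → PathSpace T d}
    (hZn : ∀ n, Measurable (Zn n))
    (hweak : ∀ G : Set (PathSpace T d), IsOpen G →
      P.map Z G ≤ liminf (fun n => (Pn n).map (Zn n) G) atTop)
    {κ : ∀ t : ℕ, Kernel (HistSpace T d t) (PathSpace T d)} [∀ t, IsMarkovKernel (κ t)]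
    {κn : ∀ _n t : ℕ, Kernel (HistSpace T d t) (PathSpace T d)} [∀ n t, IsMarkovKernel (κn n t)]
    (hκ : ∀ t, HasCondDistrib Z (fun ω => upTo t (Z ω)) (κ t) P)
    (hκn : ∀ n t, HasCondDistrib (Zn n) (fun ω => upTo t (Zn n ω)) (κn n t) (Pn n))
    (hcond : ∀ t < T, ∀ (zn : ℕ → HistSpace T d t) (z : HistSpace T d t),
      (∀ n, zn n ∈ ((Pn n).map fun ω => upTo t (Zn n ω)).support) →
      z ∈ (P.map fun ω => upTo t (Z ω)).support → Tendsto zn atTop (𝓝 z) →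
        (∀ G : Set (PathSpace T d), IsOpen G →
          κ t z G ≤ liminf (fun n => κn n t (zn n) G) atTop) ∧
        UnifIntegrableLaws fun n => (κn n t (zn n)).map cashNorm)
    (hgauss : ∀ (t : ℕ) (ht : t < T), ∀ᵐ z ∂(P.map fun ω => upTo t (Z ω)),
      ∃ m v, (κ t z).map (nextPayoff k μ κ ht) = gaussianReal m v) (t : ℕ) :
    ∃ (S : ℕ → Set (HistSpace T d t)) (S' : Set (HistSpace T d t)) (C : ℝ≥0),
      (∀ n, ∀ᵐ z ∂((Pn n).map fun ω => upTo t (Zn n ω)), z ∈ S n) ∧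
      (∀ᵐ z ∂(P.map fun ω => upTo t (Z ω)), z ∈ S') ∧
      (∀ n, ∀ y ∈ S n, ENNReal.ofReal |kernelValue k μ (κn n) t y|
        ≤ C * ∫⁻ z, ENNReal.ofReal (cashNorm z) ∂(κn n t y)) ∧
      ∀ y ∈ S', Tendsto (fun p : ℕ × HistSpace T d t => kernelValue k μ (κn p.1) t p.2)
        ((atTop ×ˢ 𝓝 y) ⊓ 𝓟 {p | p.2 ∈ S p.1}) (𝓝 (kernelValue k μ κ t y)) := by
  have hZt : ∀ t, Measurable fun ω => upTo t (Z ω) := fun t => (measurable_upTo t).comp hZ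
  have hZnt : ∀ n t, Measurable fun ω => upTo t (Zn n ω) :=
    fun n t => (measurable_upTo t).comp (hZn n)
  refine backward_induction (T := T) (fun t ht => ?_) (fun t ht ih => ?_) t
  · refine ⟨fun _ => Set.univ, Set.univ, 0, fun n => ae_of_all _ fun z => Set.mem_univ z,
      ae_of_all _ fun z => Set.mem_univ z, fun n y _ => ?_, fun y _ => ?_⟩
    · simp [kernelValue_of_le _ ht]
    · simp only [kernelValue_of_le _ ht]
      exact tendsto_const_nhds
  · obtain ⟨S, S', C, hSae, hS'ae, hS, hlim⟩ := ih
    obtain ⟨K, hK0, hK⟩ := k.exists_abs_onLaw_le hk ht (hμ t ht)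
    lift K to ℝ≥0 using hK0
    have hsupp : ∀ ν : Measure (HistSpace T d t), ∀ᵐ z ∂ν, z ∈ ν.support :=
      fun ν => Measure.support_mem_ae
    -- Good pasts: in the support, where the conditional hypotheses apply; leading almost surely to
    -- good pasts at `t + 1`; and satisfying the tower property.
    let S₁ : ℕ → Set (HistSpace T d t) := fun n =>
      {z | z ∈ ((Pn n).map fun ω => upTo t (Zn n ω)).support ∧
        (∀ᵐ z' ∂(κn n t z), upTo (t + 1) z' ∈ S n) ∧
        ∀ f : PathSpace T d → ℝ≥0∞, Measurable f →
          ∫⁻ z', ∫⁻ y, f y ∂(κn n (t + 1) (upTo (t + 1) z')) ∂(κn n t z)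
            = ∫⁻ y, f y ∂(κn n t z)}
    have hS₁ : ∀ n, ∀ᵐ z ∂((Pn n).map fun ω => upTo t (Zn n ω)), z ∈ S₁ n := fun n =>
      (hsupp _).and ((ae_ae_upTo_mem (hZn n) (hκn n) t (hSae n)).and
        (lintegral_kernel_tower_ae (hZn n) (hκn n) t))
    refine ⟨S₁, {z | z ∈ (P.map fun ω => upTo t (Z ω)).support ∧
        (∀ᵐ z' ∂(κ t z), upTo (t + 1) z' ∈ S') ∧
        ∃ m v, (κ t z).map (nextPayoff k μ κ ht) = gaussianReal m v}, (K + 1) * (1 + C), hS₁,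
      (hsupp _).and ((ae_ae_upTo_mem hZ hκ t hS'ae).and (hgauss t ht)), ?_, ?_⟩
    · rintro n y ⟨-, hy1, hy2⟩
      exact ofReal_abs_kernelValue_le hμ ht hK (hS n) hy1 hy2
    · rintro z ⟨hz1, hz2, hz3⟩
      refine tendsto_prod_inf_principal_of_forall_seq (f := fun n => kernelValue k μ (κn n) t)
        (S := S₁) (z := z) (b := kernelValue k μ κ t z)
        ?_ fun zn hzn hlimz => ?_
      · have := fun n => Measure.isProbabilityMeasure_map (μ := Pn n) (hZnt n t).aemeasurable
        refine exists_seq_mem_tendsto_of_mem_support (fun G hG => ?_) hS₁ hz1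
        have h := hweak _ (hG.preimage (continuous_upTo t))
        rw [Measure.map_apply hZ (measurable_upTo t hG.measurableSet)] at h
        simp_rw [fun n => Measure.map_apply (μ := Pn n) (hZn n)
          (measurable_upTo t hG.measurableSet)] at h
        rw [Measure.map_apply (hZt t) hG.measurableSet]
        simp_rw [fun n => Measure.map_apply (μ := Pn n) (hZnt n t) hG.measurableSet]
        exact h
      · obtain ⟨hc1, hc2⟩ := hcond t ht zn z (fun n => (hzn n).1) hz1 hlimz
        exact tendsto_kernelValue_of_tendsto hk hμ ht hS hlim (fun n => (hzn n).2.1)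
          (fun n => (hzn n).2.2) hz2 hz3 hc1 hc2

end Convergence

/-! ### Gaussian regression, independence of residuals, conditional variance. -/

section Projection

variable {Ω : Type*} [mΩ : MeasurableSpace Ω] {P : Measure Ω} [IsProbabilityMeasure P]

/-- Solvability of the normal equations without assuming the covariance nondegenerate: the
right-hand side kills the kernel of the covariance form, hence lies in the range of its transpose.
-/
theorem exists_covariance_eq {F : Type*} [AddCommGroup F] [Module ℝ F] [FiniteDimensional ℝ F]
    (V : F →ₗ[ℝ] (Ω → ℝ)) (hV : ∀ L, MemLp (V L) 2 P) {U : Ω → ℝ} (hU : MemLp U 2 P) :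
    ∃ B : F, ∀ L, cov[V L, U; P] = cov[V L, V B; P] := by
  let c : F →ₗ[ℝ] Module.Dual ℝ F := LinearMap.mk₂ ℝ (fun L B => cov[V L, V B; P])
    (fun L L' B => by rw [map_add, covariance_add_left (hV L) (hV L') (hV B)])
    (fun a L B => by rw [map_smul, covariance_smul_left, smul_eq_mul])
    (fun L B B' => by rw [map_add, covariance_add_right (hV L) (hV B) (hV B')])
    (fun a L B => by rw [map_smul, covariance_smul_right, smul_eq_mul])
  let u : Module.Dual ℝ F :=
    { toFun := fun L => cov[V L, U; P]
      map_add' := fun L L' => by rw [map_add, covariance_add_left (hV L) (hV L') hU]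
      map_smul' := fun a L => by rw [map_smul, covariance_smul_left, smul_eq_mul, RingHom.id_apply] }
  have hu : u ∈ (LinearMap.ker c).dualAnnihilator := by
    rw [Submodule.mem_dualAnnihilator]
    intro L hL
    -- A direction in the kernel has zero variance, so it is almost surely constant and uncorrelated
    -- with `U`.
    have h0 : cov[V L, V L; P] = 0 := by
      have := LinearMap.congr_fun (LinearMap.mem_ker.1 hL) L
      simpa [c] using this
    rw [covariance_self (hV L).aemeasurable] at h0
    have hae := ae_eq_integral_of_variance_eq_zero (hV L) h0
    change cov[V L, U; P] = 0
    unfold covariance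
    refine integral_eq_zero_of_ae ?_
    filter_upwards [hae] with ω hω
    rw [hω]
    simp
  rw [← LinearMap.range_dualMap_eq_dualAnnihilator_ker] at hu
  obtain ⟨ψ, hψ⟩ := hu
  obtain ⟨B, rfl⟩ := (Module.evalEquiv ℝ F).surjective ψ
  exact ⟨B, fun L => (LinearMap.congr_fun hψ L).symm⟩

/-- Gaussian regression: a jointly Gaussian variable minus a suitable linear function of `V` is
independent of `V`. -/
theorem exists_indepFun_sub {E : Type*} [NormedAddCommGroup E] [NormedSpace ℝ E]
    [FiniteDimensional ℝ E] [MeasurableSpace E] [BorelSpace E] [SecondCountableTopology E]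
    [FiniteDimensional ℝ (StrongDual ℝ E)] [CompleteSpace E]
    {V : Ω → E} {U : Ω → ℝ} (h : HasGaussianLaw (fun ω => (V ω, U ω)) P) :
    ∃ B : StrongDual ℝ E, IndepFun V (fun ω => U ω - B (V ω)) P := by
  have hV : ∀ L : StrongDual ℝ E, MemLp (fun ω => L (V ω)) 2 P :=
    fun L => (h.fst.map_fun L).memLp_two
  let W : StrongDual ℝ E →ₗ[ℝ] (Ω → ℝ) :=
    { toFun := fun L ω => L (V ω)
      map_add' := fun _ _ => rfl
      map_smul' := fun _ _ => rfl }
  obtain ⟨B, hB⟩ := exists_covariance_eq W hV h.snd.memLp_two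
  refine ⟨B, ?_⟩
  have hG : HasGaussianLaw (fun ω => (V ω, U ω - B (V ω))) P :=
    h.map_fun ((ContinuousLinearMap.fst ℝ E ℝ).prod
      (ContinuousLinearMap.snd ℝ E ℝ - B.comp (ContinuousLinearMap.fst ℝ E ℝ)))
  refine hG.indepFun_of_covariance_strongDual fun L₁ L₂ => ?_
  have h2 : L₂ ∘ (fun ω => U ω - B (V ω)) = fun ω => (U ω - B (V ω)) * L₂ 1 := by
    funext ω
    rw [Function.comp_apply, ← smul_eq_mul, ← map_smul]
    simp
  rw [h2, covariance_mul_const_right]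
  have h3 : cov[L₁ ∘ V, fun ω => U ω - B (V ω); P] = 0 := by
    have := hB L₁
    change cov[L₁ ∘ V, U; P] = cov[L₁ ∘ V, fun ω => B (V ω); P] at this
    have hV₁ : MemLp (L₁ ∘ V) 2 P := hV L₁
    rw [covariance_fun_sub_right hV₁ h.snd.memLp_two (hV B), this, sub_self]
  rw [h3, zero_mul]

/-- Under joint Gaussianity independence is vanishing covariance, which is additive. -/
theorem IndepFun.add_right_of_hasGaussianLaw {E : Type*} [NormedAddCommGroup E] [NormedSpace ℝ E]
    [MeasurableSpace E] [BorelSpace E] [SecondCountableTopology E] [CompleteSpace E]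
    {V : Ω → E} {ξ ξ' : Ω → ℝ} (h : HasGaussianLaw (fun ω => (V ω, ξ ω + ξ' ω)) P)
    (hξ : MemLp ξ 2 P) (hξ' : MemLp ξ' 2 P) (h1 : IndepFun V ξ P) (h2 : IndepFun V ξ' P) :
    IndepFun V (fun ω => ξ ω + ξ' ω) P := by
  refine h.indepFun_of_covariance_strongDual fun L₁ L₂ => ?_
  have hV : MemLp (L₁ ∘ V) 2 P := (h.fst.map L₁).memLp_two
  have hL : L₂ ∘ (fun ω => ξ ω + ξ' ω) = fun ω => (ξ + ξ') ω * L₂ 1 := by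
    funext ω
    rw [Function.comp_apply, ← smul_eq_mul, ← map_smul]
    simp
  have hz1 : cov[L₁ ∘ V, ξ; P] = 0 :=
    IndepFun.covariance_eq_zero (h1.comp L₁.measurable measurable_id) hV hξ
  have hz2 : cov[L₁ ∘ V, ξ'; P] = 0 :=
    IndepFun.covariance_eq_zero (h2.comp L₁.measurable measurable_id) hV hξ'
  rw [hL, covariance_mul_const_right, covariance_add_right hV hξ hξ', hz1, hz2]
  simp

theorem condVar_add_of_indep {m : MeasurableSpace Ω} (hm : m ≤ mΩ) {G ξ : Ω → ℝ}
    (hG : StronglyMeasurable[m] G) (hGi : Integrable G P) (hξm : Measurable[mΩ] ξ) (hξ : MemLp ξ 2 P)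
    (hind : Indep (MeasurableSpace.comap ξ inferInstance) m P) :
    condVar m (fun ω => G ω + ξ ω) P =ᵐ[P] fun _ => Var[ξ; P] := by
  have hξi : Integrable ξ P := hξ.integrable (by norm_num)
  have h1 : P[ξ | m] =ᵐ[P] fun _ => P[ξ] :=
    condExp_indep_eq hξm.comap_le hm (comap_measurable ξ).stronglyMeasurable hind
  have h2 : P[fun ω => G ω + ξ ω | m] =ᵐ[P] fun ω => G ω + P[ξ] := by
    filter_upwards [condExp_add hGi hξi m, h1] with ω h h'
    change (P[G + ξ | m]) ω = _
    rw [h, Pi.add_apply, h', condExp_of_stronglyMeasurable hm hG hGi]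
  have h3 : (fun ω => (G ω + ξ ω - (P[fun ω => G ω + ξ ω | m]) ω) ^ 2)
      =ᵐ[P] fun ω => (ξ ω - P[ξ]) ^ 2 := by
    filter_upwards [h2] with ω h
    rw [h]
    ring
  have h4 : P[fun ω => (ξ ω - P[ξ]) ^ 2 | m] =ᵐ[P] fun _ => ∫ ω, (ξ ω - P[ξ]) ^ 2 ∂P := by
    refine condExp_indep_eq hξm.comap_le hm ?_ hind
    exact (((comap_measurable ξ).sub_const _).pow_const 2).stronglyMeasurable
  rw [variance_eq_integral hξm.aemeasurable]
  exact (condExp_congr_ae h3).trans h4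

end Projection

/-! ### Conditional laws of known quantity plus independent noise. -/

section ConditionalLaw

variable {Ω : Type*} [mΩ : MeasurableSpace Ω] {P : Measure Ω} [IsProbabilityMeasure P]

theorem kernel_ae_eq_map_add_of_indepFun {α : Type*} [MeasurableSpace α] {V : Ω → α}
    (hV : Measurable V) {ξ W : Ω → ℝ} (hξ : Measurable ξ) (hind : IndepFun V ξ P) {g : α → ℝ}
    (hg : Measurable g) (hW : W =ᵐ[P] fun ω => g (V ω) + ξ ω) {η : Kernel α ℝ} [IsMarkovKernel η]
    (hη : HasCondDistrib W V η P) :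
    ∀ᵐ z ∂(P.map V), η z = (P.map ξ).map fun x => g z + x := by
  have hprobV := Measure.isProbabilityMeasure_map (μ := P) hV.aemeasurable
  have hprobξ := Measure.isProbabilityMeasure_map (μ := P) hξ.aemeasurable
  have hadd : Measurable fun p : α × ℝ => g p.1 + p.2 := by fun_prop
  let η' : Kernel α ℝ := (Kernel.id ×ₖ Kernel.const α (P.map ξ)).map fun p => g p.1 + p.2
  have hη'm : IsMarkovKernel η' := Kernel.IsMarkovKernel.map _ hadd
  have hη'a : ∀ z, η' z = (P.map ξ).map fun x => g z + x := by
    intro z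
    rw [Kernel.map_apply _ hadd, Kernel.prod_apply, Kernel.id_apply, Kernel.const_apply,
      Measure.dirac_prod, Measure.map_map hadd (by fun_prop)]
    rfl
  have hmap : P.map (fun ω => (V ω, W ω)) = P.map V ⊗ₘ η' := by
    have hcongr : P.map (fun ω => (V ω, W ω)) = P.map (fun ω => (V ω, g (V ω) + ξ ω)) := by
      refine Measure.map_congr ?_
      filter_upwards [hW] with ω hω
      rw [hω]
    rw [hcongr]
    refine Measure.ext_of_lintegral _ fun f hf => ?_
    have hf' : Measurable fun p : α × ℝ => f (p.1, g p.1 + p.2) := by fun_prop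
    calc _ = ∫⁻ ω, f (V ω, g (V ω) + ξ ω) ∂P :=
          lintegral_map hf (hV.prodMk ((hg.comp hV).add hξ))
      _ = ∫⁻ p, f (p.1, g p.1 + p.2) ∂(P.map fun ω => (V ω, ξ ω)) := by
          rw [lintegral_map hf' (hV.prodMk hξ)]
      _ = ∫⁻ z, ∫⁻ x, f (z, g z + x) ∂(P.map ξ) ∂(P.map V) := by
          rw [(indepFun_iff_map_prod_eq_prod_map_map hV.aemeasurable hξ.aemeasurable).1 hind,
            lintegral_prod _ hf'.aemeasurable]
      _ = _ := by
          rw [Measure.lintegral_compProd hf]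
          refine lintegral_congr fun z => ?_
          rw [hη'a]
          exact (lintegral_map (hf.comp measurable_prodMk_left) (measurable_const_add _)).symm
  have h1 := condDistrib_ae_eq_of_measure_eq_compProd V hη.aemeasurable_snd hη.map_eq
  have h2 := condDistrib_ae_eq_of_measure_eq_compProd V hη.aemeasurable_snd hmap
  filter_upwards [h1, h2] with z hz1 hz2
  rw [← hz1, hz2, hη'a]

end ConditionalLaw

theorem map_const_add_eq_map_affine_gaussianReal {Ω : Type*} [MeasurableSpace Ω] {P : Measure Ω}
    {ξ : Ω → ℝ} (hξ : HasGaussianLaw ξ P) (a : ℝ) :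
    (P.map ξ).map (fun x => a + x)
      = (gaussianReal 0 1).map fun x => (a + P[ξ]) + Real.sqrt Var[ξ; P] * x := by
  have h1 : (fun x : ℝ => (a + P[ξ]) + Real.sqrt Var[ξ; P] * x)
      = (fun x => (a + P[ξ]) + x) ∘ fun x => Real.sqrt Var[ξ; P] * x := rfl
  rw [h1, ← Measure.map_map (by fun_prop) (by fun_prop), gaussianReal_map_const_mul,
    gaussianReal_map_const_add, hξ.map_eq_gaussianReal, gaussianReal_map_const_add]
  congr 1
  · ring
  · ext
    simp [Real.sq_sqrt (variance_nonneg ξ P), variance_nonneg ξ P]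

/-! ### Valuation of a payoff independent of the conditioning σ-algebra. -/

section StandardNormal

theorem hasCondDistrib_const_of_indepFun {Ω α : Type*} [MeasurableSpace Ω] [MeasurableSpace α]
    {P : Measure Ω} [IsProbabilityMeasure P] {V : Ω → α} (hV : Measurable V) {W : Ω → ℝ}
    (hW : Measurable W) (h : IndepFun V W P) :
    HasCondDistrib W V (Kernel.const α (P.map W)) P := by
  have := Measure.isProbabilityMeasure_map (μ := P) hW.aemeasurable
  refine ⟨(hV.prodMk hW).aemeasurable, ?_⟩
  rw [(indepFun_iff_map_prod_eq_prod_map_map hV.aemeasurable hW.aemeasurable).1 h,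
    Measure.compProd_const]

theorem ValuationRule.phi_ae_eq_of_indep {T : ℕ} {k : ValuationRule} {μ : ℕ → Measure ℝ} {t : ℕ}
    (hk : k.Admissible T) (ht : t < T) (hμ : IsQuantileWeight (μ t)) {Ω : Type*}
    {m mΩ : MeasurableSpace Ω} {P : Measure Ω} [IsProbabilityMeasure P] (hm : m ≤ mΩ) {W : Ω → ℝ}
    (hWm : Measurable[mΩ] W) (hW : Integrable W P)
    (hind : Indep (MeasurableSpace.comap W inferInstance) m P) :
    k.phi μ t m P W =ᵐ[P] fun _ => k.onLaw μ t (P.map W) := by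
  have hprob : IsProbabilityMeasure (P.map W) := Measure.isProbabilityMeasure_map hW.1.aemeasurable
  have hindep : @IndepFun Ω Ω ℝ mΩ m _ id W P := by
    refine (@IndepFun_iff_Indep Ω Ω ℝ mΩ m _ id W P).2 ?_
    rw [MeasurableSpace.comap_id]
    exact hind.symm
  have hcd := @hasCondDistrib_const_of_indepFun Ω Ω mΩ m P _ id (measurable_id'' hm) W hWm hindep
  filter_upwards [k.phi_ae_eq_onLaw hk ht hμ hm hW, condLaw_ae_eq hm hW.1.aemeasurable hcd]
    with ω h1 h2
  rw [h1, h2, Kernel.const_apply]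

end StandardNormal

/-! ### The affine value and its variance formula in the Gaussian model. -/

section GaussianModel

variable {T d : ℕ}

/-- The cashflow at the time with index `i`, as a linear functional of the path. -/
noncomputable def cashflowCLM (i : Fin T) : StrongDual ℝ (PathSpace T d) :=
  (ContinuousLinearMap.fst ℝ ℝ (Fin d → ℝ)).comp (ContinuousLinearMap.proj i)

/-- The restriction to the past up to time `t`, as a linear map. -/
noncomputable def upToCLM (t : ℕ) : PathSpace T d →L[ℝ] HistSpace T d t :=
  ContinuousLinearMap.pi fun i => ContinuousLinearMap.proj i.1

theorem remaining_of_le {Ω : Type*} (X : Ω → Fin T → ℝ) {t : ℕ} (ht : T ≤ t) (ω : Ω) :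
    remaining X t ω = 0 :=
  Finset.sum_eq_zero fun i _ => if_neg (by have := i.2; omega)

theorem remaining_of_lt {Ω : Type*} (X : Ω → Fin T → ℝ) {t : ℕ} (ht : t < T) (ω : Ω) :
    remaining X t ω = X ω ⟨t, ht⟩ + remaining X (t + 1) ω := by
  unfold remaining
  have h : ∀ i : Fin T, (if t ≤ (i : ℕ) then X ω i else 0)
      = (if i = ⟨t, ht⟩ then X ω i else 0) + if t + 1 ≤ (i : ℕ) then X ω i else 0 := by
    intro i
    rcases lt_trichotomy (i : ℕ) t with h | h | h
    · rw [if_neg (by omega), if_neg (by rw [Fin.ext_iff]; exact h.ne), if_neg (by omega), add_zero]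
    · rw [if_pos h.ge, if_pos (Fin.ext h), if_neg (by omega), add_zero]
    · rw [if_pos h.le, if_neg (by rw [Fin.ext_iff]; exact h.ne'),
        if_pos (Nat.succ_le_of_lt h), zero_add]
  simp_rw [h]
  rw [Finset.sum_add_distrib, Finset.sum_ite_eq' Finset.univ, if_pos (Finset.mem_univ _)]

theorem exists_remaining_eq (t : ℕ) : ∃ R : StrongDual ℝ (PathSpace T d),
    ∀ {Ω : Type u} (X : Ω → Fin T → ℝ) (Y : Ω → Fin T → Fin d → ℝ) (ω : Ω),
      remaining X t ω = R (joint X Y ω) := by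
  refine ⟨∑ i : Fin T, if t ≤ (i : ℕ) then cashflowCLM i else 0, fun X Y ω => ?_⟩
  rw [sum_apply]
  refine Finset.sum_congr rfl fun i _ => ?_
  split_ifs <;> rfl

/-- The independence clause says that `A` of the past is, up to a constant, the conditional mean of
the remaining cashflow; it is what lets the induction identify variances. The formula for `b` holds
almost surely because `condVar` is determined only up to null sets. -/
theorem exists_affine_kernelValue {k : ValuationRule} {μ : ℕ → Measure ℝ}
    (hk : k.Admissible T) (hμ : ∀ t < T, IsQuantileWeight (μ t))
    {Ω : Type u} [mΩ : MeasurableSpace Ω] {P : Measure Ω} [IsProbabilityMeasure P]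
    {X : Ω → Fin T → ℝ} {Y : Ω → Fin T → Fin d → ℝ} (hX : Measurable X) (hY : Measurable Y)
    (hG : HasGaussianLaw (joint X Y) P)
    {κ : ∀ t : ℕ, Kernel (HistSpace T d t) (PathSpace T d)} [∀ t, IsMarkovKernel (κ t)]
    (hκ : ∀ t, HasCondDistrib (joint X Y) (fun ω => upTo t (joint X Y ω)) (κ t) P) (t : ℕ) :
    ∃ (A : StrongDual ℝ (HistSpace T d t)) (b : ℝ),
      (∀ᵐ z ∂(P.map fun ω => upTo t (joint X Y ω)), kernelValue k μ κ t z = A z + b) ∧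
      IndepFun (fun ω => upTo t (joint X Y ω))
        (fun ω => remaining X t ω - A (upTo t (joint X Y ω))) P ∧
      (∀ᵐ ω ∂P, b = (∫ ω', (remaining X t ω' - A (upTo t (joint X Y ω'))) ∂P) +
        ∑ s ∈ Finset.Ico t T, k.onLaw μ s (gaussianReal 0 1) *
          Real.sqrt (condVar (histSigma X Y s) (remaining X s) P ω
            - condVar (histSigma X Y (s + 1)) (remaining X s) P ω)) ∧
      ∀ ht : t < T, ∀ᵐ z ∂(P.map fun ω => upTo t (joint X Y ω)),
        ∃ m v, (κ t z).map (nextPayoff k μ κ ht) = gaussianReal m v := by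
  have hZ := measurable_joint hX hY
  have hZt : ∀ t, Measurable fun ω => upTo t (joint X Y ω) := fun t => (measurable_upTo t).comp hZ
  refine backward_induction (T := T) (fun t ht => ?_) (fun t ht ih => ?_) t
  · refine ⟨0, 0, ae_of_all _ fun z => ?_, ?_, ae_of_all _ fun ω => ?_, fun h => absurd ht h.not_ge⟩
    · simp [kernelValue_of_le κ ht]
    · simp only [remaining_of_le X ht, zero_apply, sub_zero]
      exact indepFun_const_right _ _
    · simp [remaining_of_le X ht, Finset.Ico_eq_empty_of_le ht]
  · obtain ⟨A, b, ih1, ih2, ih3, -⟩ := ih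
    have ih1' := ae_of_ae_map (hZt (t + 1)).aemeasurable ih1
    obtain ⟨R, hR⟩ := exists_remaining_eq.{u} (T := T) (d := d) (t + 1)
    let L : StrongDual ℝ (PathSpace T d) := cashflowCLM ⟨t, ht⟩ + A.comp (upToCLM (t + 1))
    -- The next payoff is, almost surely, `L` of the path plus the constant `b`. Regressing `L` on
    -- the past at `t` gives the new slope `B` and the innovation `ξ`; `ξ'` is the residual left
    -- over from time `t + 1`.
    obtain ⟨B, hB⟩ := exists_indepFun_sub
      (V := fun ω => upTo t (joint X Y ω)) (U := fun ω => L (joint X Y ω))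
      (hG.map_fun ((upToCLM t).prod L))
    set ξ : Ω → ℝ := fun ω => L (joint X Y ω) - B (upTo t (joint X Y ω)) with hξdef
    set ξ' : Ω → ℝ := fun ω => remaining X (t + 1) ω - A (upTo (t + 1) (joint X Y ω)) with hξ'def
    have hξG : HasGaussianLaw ξ P := hG.map_fun (L - B.comp (upToCLM t))
    have hξ'e : ξ' = fun ω => (R - A.comp (upToCLM (t + 1))) (joint X Y ω) := by
      funext ω
      rw [hξ'def]
      simp only
      rw [hR X Y]
      rfl
    have hξ'G : HasGaussianLaw ξ' P := by
      rw [hξ'e]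
      exact hG.map_fun _
    have hξm : Measurable ξ := (L - B.comp (upToCLM t)).measurable.comp hZ
    have hξ'm : Measurable ξ' := by
      rw [hξ'e]
      exact (R - A.comp (upToCLM (t + 1))).measurable.comp hZ
    let pr : HistSpace T d (t + 1) → HistSpace T d t := fun z i => z ⟨i.1, i.2.trans t.lt_succ_self⟩
    have hpr : Measurable pr := measurable_pi_lambda _ fun _ => measurable_pi_apply _
    let ℓ : HistSpace T d (t + 1) → ℝ := fun z => (z ⟨⟨t, ht⟩, t.lt_succ_self⟩).1 + A z
    have hℓ : Measurable ℓ := (measurable_fst.comp (measurable_pi_apply _)).add A.measurable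
    have hLℓ : ∀ ω, L (joint X Y ω) = ℓ (upTo (t + 1) (joint X Y ω)) := fun ω => rfl
    have hVξ' : IndepFun (fun ω => upTo t (joint X Y ω)) ξ' P := ih2.comp hpr measurable_id
    -- `ξ` is a function of the past at `t + 1`, of which `ξ'` is independent.
    have hξξ' : IndepFun ξ ξ' P :=
      ih2.comp (φ := fun z => ℓ z - B (pr z)) (hℓ.sub (B.measurable.comp hpr)) measurable_id
    have hrem : ∀ ω, remaining X t ω = B (upTo t (joint X Y ω)) + (ξ ω + ξ' ω) := by
      intro ω
      have hL : L (joint X Y ω) = X ω ⟨t, ht⟩ + A (upTo (t + 1) (joint X Y ω)) := rfl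
      rw [remaining_of_lt X ht, hξdef, hξ'def]
      simp only
      rw [hL]
      ring
    have hrem' : ∀ ω, remaining X t ω = L (joint X Y ω) + ξ' ω := by
      intro ω
      rw [hrem, hξdef]
      simp only
      ring
    have hsum : IndepFun (fun ω => upTo t (joint X Y ω)) (fun ω => ξ ω + ξ' ω) P := by
      refine IndepFun.add_right_of_hasGaussianLaw ?_ hξG.memLp_two hξ'G.memLp_two hB hVξ'
      rw [hξ'e]
      exact hG.map_fun ((upToCLM t).prod ((L - B.comp (upToCLM t))
        + (R - A.comp (upToCLM (t + 1)))))
    have hm : Measurable (nextPayoff k μ κ ht) := measurable_nextPayoff hμ κ ht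
    have hWe : nextPayoff k μ κ ht ∘ joint X Y
        =ᵐ[P] fun ω => (B (upTo t (joint X Y ω)) + b) + ξ ω := by
      filter_upwards [ih1'] with ω hω
      have hL : L (joint X Y ω) = X ω ⟨t, ht⟩ + A (upTo (t + 1) (joint X Y ω)) := rfl
      rw [hξdef]
      simp only [Function.comp_apply, nextPayoff]
      rw [hω, hL]
      change X ω ⟨t, ht⟩ + _ = _
      ring
    have hmk := Kernel.IsMarkovKernel.map (κ t) hm
    have hlaw : ∀ᵐ z ∂(P.map fun ω => upTo t (joint X Y ω)), (κ t z).map (nextPayoff k μ κ ht)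
        = (gaussianReal 0 1).map fun x => (B z + b + P[ξ]) + Real.sqrt Var[ξ; P] * x := by
      filter_upwards [kernel_ae_eq_map_add_of_indepFun (hZt t) hξm hB
        (B.measurable.add_const b) hWe ((hκ t).comp_left hm)] with z hz
      rw [← Kernel.map_apply _ hm, hz, map_const_add_eq_map_affine_gaussianReal hξG]
    have hid : Integrable (fun x : ℝ => x) (gaussianReal 0 1) :=
      (memLp_id_gaussianReal 1).integrable (by simp)
    refine ⟨B, b + P[ξ] + Real.sqrt Var[ξ; P] * k.onLaw μ t (gaussianReal 0 1), ?_, ?_, ?_, ?_⟩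
    · filter_upwards [hlaw] with z hz
      rw [kernelValue_of_lt κ ht, hz,
        k.onLaw_map_affine hk ht (hμ t ht) hid _ (Real.sqrt_nonneg _)]
      ring
    · convert hsum using 2 with ω
      rw [hrem]
      ring
    · have hvar1 : condVar (histSigma X Y t) (remaining X t) P =ᵐ[P]
          fun _ => Var[fun ω => ξ ω + ξ' ω; P] := by
        rw [show remaining X t = fun ω => B (upTo t (joint X Y ω)) + (ξ ω + ξ' ω) from funext hrem]
        refine condVar_add_of_indep (histSigma_le hX hY t) ?_ ?_ (hξm.add hξ'm)
          (hξG.memLp_two.add hξ'G.memLp_two) ?_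
        · exact (B.measurable.comp (comap_measurable _)).stronglyMeasurable
        · exact (hG.map_fun (B.comp (upToCLM t))).integrable
        · exact ((IndepFun_iff_Indep _ _ _).1 hsum).symm
      have hvar2 : condVar (histSigma X Y (t + 1)) (remaining X t) P =ᵐ[P]
          fun _ => Var[ξ'; P] := by
        rw [show remaining X t = fun ω => L (joint X Y ω) + ξ' ω from funext hrem']
        refine condVar_add_of_indep (histSigma_le hX hY (t + 1)) ?_ ?_ hξ'm hξ'G.memLp_two ?_
        · exact (hℓ.comp (comap_measurable _)).stronglyMeasurable
        · exact (hG.map_fun L).integrable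
        · exact ((IndepFun_iff_Indep _ _ _).1 ih2).symm
      -- Given the past at `t` the variance is that of `ξ + ξ'`, given the past at `t + 1` only that
      -- of `ξ'`; the difference is the squared scale of the next payoff.
      have hvar : Var[fun ω => ξ ω + ξ' ω; P] = Var[ξ; P] + Var[ξ'; P] :=
        hξξ'.variance_add hξG.memLp_two hξ'G.memLp_two
      filter_upwards [ih3, hvar1, hvar2] with ω h1 h2 h3
      have hint : ∫ ω', (remaining X t ω' - B (upTo t (joint X Y ω'))) ∂P = P[ξ] + P[ξ'] := by
        rw [← integral_add hξG.integrable hξ'G.integrable]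
        refine integral_congr_ae (ae_of_all _ fun ω' => ?_)
        simp only [hrem]
        ring
      rw [Finset.sum_eq_sum_Ico_succ_bot ht, hint, h2, h3, hvar, add_sub_cancel_right]
      conv_lhs => rw [h1]
      ring
    · intro _
      filter_upwards [hlaw] with z hz
      refine ⟨P[ξ] + (B z + b), Var[ξ; P].toNNReal, ?_⟩
      rw [hz, ← map_const_add_eq_map_affine_gaussianReal hξG, hξG.map_eq_gaussianReal,
        gaussianReal_map_const_add]

end GaussianModel

theorem integrable_of_unifIntegrableLaws_euclNorm {T : ℕ} {Ωn : ℕ → Type*}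
    [∀ n, MeasurableSpace (Ωn n)] {Pn : ∀ n, Measure (Ωn n)} [∀ n, IsProbabilityMeasure (Pn n)]
    {Xn : ∀ n, Ωn n → Fin T → ℝ} (hXn : ∀ n, Measurable (Xn n))
    (hUI : UnifIntegrableLaws fun n => (Pn n).map (fun ω => euclNorm (Xn n ω))) (n : ℕ)
    (i : Fin T) : Integrable (fun ω => Xn n ω i) (Pn n) := by
  have hc : Continuous (euclNorm : (Fin T → ℝ) → ℝ) := by
    unfold euclNorm
    fun_prop
  have hm : ∀ n, Measurable fun ω => euclNorm (Xn n ω) := fun n => hc.measurable.comp (hXn n)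
  have hUI' : UnifIntegrableLaws fun n => ((Pn n).map (Xn n)).map euclNorm := by
    simpa only [Measure.map_map hc.measurable (hXn _), Function.comp_def] using hUI
  obtain ⟨r, -, hr⟩ := exists_lintegral_ofReal_sub_le hc.measurable
    (fun x => Real.sqrt_nonneg _) hUI' one_pos
  have hint : Integrable (fun x : ℝ => x) ((Pn n).map fun ω => euclNorm (Xn n ω)) := by
    have := Measure.isProbabilityMeasure_map (μ := Pn n) (hm n).aemeasurable
    refine integrable_of_lintegral_ofReal_abs_sub_ne_top (r := r) ?_
    rw [lintegral_map (by fun_prop) (hm n)]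
    refine ((le_of_eq ?_).trans (hr n)).trans_lt ENNReal.one_lt_top |>.ne
    rw [lintegral_map (by fun_prop) (hXn n)]
    refine lintegral_congr fun ω => ?_
    rw [abs_of_nonneg (show 0 ≤ euclNorm (Xn n ω) from Real.sqrt_nonneg _)]
  have hint' : Integrable (fun ω => euclNorm (Xn n ω)) (Pn n) :=
    (integrable_map_measure (by fun_prop) (hm n).aemeasurable).1 hint
  refine hint'.mono' ((measurable_pi_apply i).comp (hXn n)).aestronglyMeasurable
    (ae_of_all _ fun ω => ?_)
  -- With `d = 0` and a trivial second component, the cashflow norm is the Euclidean norm.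
  exact abs_fst_le_cashNorm (d := 0) (fun i => (Xn n ω i, 0)) i

theorem theorem1 {T d : ℕ} (hT : 1 ≤ T)
    -- the limit model and the prelimit models, possibly on different probability spaces
    {Ω : Type u} [MeasurableSpace Ω] (P : Measure Ω) [IsProbabilityMeasure P]
    {Ωn : ℕ → Type v} [∀ n, MeasurableSpace (Ωn n)] (Pn : ∀ n, Measure (Ωn n))
    [∀ n, IsProbabilityMeasure (Pn n)]
    (X : Ω → Fin T → ℝ) (Y : Ω → Fin T → Fin d → ℝ)
    (Xn : ∀ n, Ωn n → Fin T → ℝ) (Yn : ∀ n, Ωn n → Fin T → Fin d → ℝ)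
    (hX : Measurable X) (hY : Measurable Y)
    (hXn : ∀ n, Measurable (Xn n)) (hYn : ∀ n, Measurable (Yn n))
    -- weak convergence to a Gaussian limit, and uniform integrability of the norms
    (hGauss : IsGaussian (P.map (joint X Y)))
    (hweak : TendstoInDistribution (fun n => joint (Xn n) (Yn n)) atTop (joint X Y) Pn P)
    (hUI : UnifIntegrableLaws fun n => (Pn n).map (fun ω => euclNorm (Xn n ω)))
    -- regular conditional distributions of the whole process given its past up to time `t`
    (κ : ∀ t : ℕ, Kernel ({i : Fin T // (i : ℕ) < t} → ℝ × (Fin d → ℝ))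
      (Fin T → ℝ × (Fin d → ℝ)))
    [∀ t, IsMarkovKernel (κ t)]
    (κn : ∀ (_ : ℕ) (t : ℕ), Kernel ({i : Fin T // (i : ℕ) < t} → ℝ × (Fin d → ℝ))
      (Fin T → ℝ × (Fin d → ℝ)))
    [∀ n t, IsMarkovKernel (κn n t)]
    (hκ : ∀ t, HasCondDistrib (joint X Y) (fun ω => upTo t (joint X Y ω)) (κ t) P)
    (hκn : ∀ n t, HasCondDistrib (joint (Xn n) (Yn n)) (fun ω => upTo t (joint (Xn n) (Yn n) ω))
      (κn n t) (Pn n))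
    -- conditional weak convergence and conditional uniform integrability
    (hcond : ∀ t, 1 ≤ t → t ≤ T →
      ∀ (zn : ℕ → {i : Fin T // (i : ℕ) < t} → ℝ × (Fin d → ℝ))
        (z : {i : Fin T // (i : ℕ) < t} → ℝ × (Fin d → ℝ)),
        (∀ n, zn n ∈ ((Pn n).map (fun ω => upTo t (joint (Xn n) (Yn n) ω))).support) →
        z ∈ (P.map (fun ω => upTo t (joint X Y ω))).support →
        Tendsto zn atTop (𝓝 z) →
        Tendsto (β := ProbabilityMeasure (Fin T → ℝ × (Fin d → ℝ)))
            (fun n => ⟨κn n t (zn n), inferInstance⟩) atTop (𝓝 ⟨κ t z, inferInstance⟩) ∧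
          UnifIntegrableLaws fun n => (κn n t (zn n)).map cashNorm)
    -- the valuation mappings and the weights of the risk measures
    (k : ValuationRule) (hk : k.Admissible T)
    (μ : ℕ → Measure ℝ) (hμ : ∀ t < T, IsQuantileWeight (μ t)) :
    ∃ (V₀n : ℕ → ℝ) (V₀ : ℝ) (c : ℕ → ℝ),
      -- the values at time `0` are nonrandom, and they converge
      (∀ n, value k μ (Pn n) (Xn n) (Yn n) 0 =ᵐ[Pn n] fun _ => V₀n n) ∧
      (value k μ P X Y 0 =ᵐ[P] fun _ => V₀) ∧
      Tendsto V₀n atTop (𝓝 V₀) ∧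
      -- `c t` is the nonrandom value of `φ_t(ε)` for any standard normal `ε` that is independent
      -- of the conditioning σ-algebra, on any probability space
      (∀ t < T, ∀ (Ω' : Type u) (m : MeasurableSpace Ω') (mΩ' : MeasurableSpace Ω')
        (P' : Measure Ω') [IsProbabilityMeasure P'] (ε : Ω' → ℝ), m ≤ mΩ' →
        Measurable[mΩ'] ε → P'.map ε = gaussianReal 0 1 →
        Indep (MeasurableSpace.comap ε inferInstance) m P' →
        k.phi μ t m P' ε =ᵐ[P'] fun _ => c t) ∧
      -- the explicit expression of the limit
      (∀ᵐ ω ∂P, V₀ = (∫ ω', ∑ i, X ω' i ∂P) +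
        ∑ t ∈ Finset.range T, c t *
          Real.sqrt (condVar (histSigma X Y t) (remaining X t) P ω
            - condVar (histSigma X Y (t + 1)) (remaining X t) P ω)) := by
  have hG : HasGaussianLaw (joint X Y) P := ⟨hGauss⟩
  have hZ := measurable_joint hX hY
  have hZn : ∀ n, Measurable (joint (Xn n) (Yn n)) := fun n => measurable_joint (hXn n) (hYn n)
  have hsub : Subsingleton (HistSpace T d 0) :=
    ⟨fun _ _ => funext fun i => absurd i.2 (Nat.not_lt_zero _)⟩
  let z₀ : HistSpace T d 0 := fun i => absurd i.2 (Nat.not_lt_zero _)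
  have hint : ∀ i, Integrable (fun ω => X ω i) P := fun i =>
    (hG.map_fun (cashflowCLM i)).integrable
  have hopen : ∀ G : Set (PathSpace T d), IsOpen G →
      P.map (joint X Y) G ≤ liminf (fun n => (Pn n).map (joint (Xn n) (Yn n)) G) atTop :=
    fun G hG => ProbabilityMeasure.le_liminf_measure_open_of_tendsto hweak.tendsto hG
  have hcond' : ∀ t < T, ∀ (zn : ℕ → HistSpace T d t) (z : HistSpace T d t),
      (∀ n, zn n ∈ ((Pn n).map fun ω => upTo t (joint (Xn n) (Yn n) ω)).support) →
      z ∈ (P.map fun ω => upTo t (joint X Y ω)).support → Tendsto zn atTop (𝓝 z) →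
        (∀ G : Set (PathSpace T d), IsOpen G →
          κ t z G ≤ liminf (fun n => κn n t (zn n) G) atTop) ∧
        UnifIntegrableLaws fun n => (κn n t (zn n)).map cashNorm := by
    intro t ht zn z hzn hz hlim
    -- The conditional hypotheses start at time `1`; at time `0` the kernels are the unconditional
    -- laws and the unconditional hypotheses take over.
    rcases t.eq_zero_or_pos with rfl | ht0
    · simp_rw [kernel_zero_eq_map hZ (hκ 0), fun n => kernel_zero_eq_map (hZn n) (hκn n 0)]
      refine ⟨hopen, ?_⟩
      simp_rw [fun n => Measure.map_map (μ := Pn n) measurable_cashNorm (hZn n)]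
      exact hUI
    · obtain ⟨h1, h2⟩ := hcond t ht0 ht.le zn z hzn hz hlim
      exact ⟨fun G hG => ProbabilityMeasure.le_liminf_measure_open_of_tendsto h1 hG, h2⟩
  obtain ⟨S, S', -, hS, hS', -, hlim⟩ := tendsto_kernelValue hk hμ hZ hZn hopen hκ hκn hcond'
    (fun t ht => (exists_affine_kernelValue hk hμ hX hY hG hκ t).choose_spec.choose_spec.2.2.2 ht) 0
  have hprob : IsProbabilityMeasure (P.map fun ω => upTo 0 (joint X Y ω)) :=
    Measure.isProbabilityMeasure_map ((measurable_upTo 0).comp hZ).aemeasurable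
  have hprobn : ∀ n, IsProbabilityMeasure ((Pn n).map fun ω => upTo 0 (joint (Xn n) (Yn n) ω)) :=
    fun n => Measure.isProbabilityMeasure_map ((measurable_upTo 0).comp (hZn n)).aemeasurable
  -- A set of full measure in a one-point space contains the point.
  have hzS : ∀ n, z₀ ∈ S n := fun n => by
    obtain ⟨z, hz⟩ := (hS n).exists
    rwa [Subsingleton.elim z₀ z]
  have hzS' : z₀ ∈ S' := by
    obtain ⟨z, hz⟩ := hS'.exists
    rwa [Subsingleton.elim z₀ z]
  refine ⟨fun n => kernelValue k μ (κn n) 0 z₀, kernelValue k μ κ 0 z₀,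
    fun t => k.onLaw μ t (gaussianReal 0 1), fun n => ?_, ?_, ?_, ?_, ?_⟩
  · filter_upwards [(value_ae_eq_kernelValue hk hμ (Pn n) (hXn n) (hYn n)
      (integrable_of_unifIntegrableLaws_euclNorm hXn hUI n) (hκn n) 0).1] with ω hω
    rw [hω, Subsingleton.elim z₀]
  · filter_upwards [(value_ae_eq_kernelValue hk hμ P hX hY hint hκ 0).1] with ω hω
    rw [hω, Subsingleton.elim z₀]
  · have hmap : Tendsto (fun n : ℕ => (n, z₀)) atTop
        ((atTop ×ˢ 𝓝 z₀) ⊓ 𝓟 {p | p.2 ∈ S p.1}) :=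
      tendsto_inf.2 ⟨tendsto_id.prodMk tendsto_const_nhds,
        tendsto_principal.2 (Eventually.of_forall hzS)⟩
    exact (hlim z₀ hzS').comp hmap
  · intro t ht Ω' m mΩ' P' _ ε hm hε hlaw hind
    have hεint : Integrable ε P' := by
      have h : Integrable (fun x : ℝ => x) (P'.map ε) := by
        rw [hlaw]
        exact (memLp_id_gaussianReal 1).integrable (by simp)
      exact (integrable_map_measure (by fun_prop) hε.aemeasurable).1 h
    rw [← hlaw]
    exact ValuationRule.phi_ae_eq_of_indep hk ht (hμ t ht) hm hε hεint hind
  · obtain ⟨A, b, h1, -, h3, -⟩ := exists_affine_kernelValue hk hμ hX hY hG hκ 0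
    obtain ⟨z, hz⟩ := h1.exists
    -- With no past the linear part vanishes, leaving the constant `b`.
    have hA : ∀ z, A z = 0 := fun z => by rw [Subsingleton.elim z 0, map_zero]
    filter_upwards [h3] with ω hω
    rw [Subsingleton.elim z₀ z, hz, hA, zero_add, hω, Finset.range_eq_Ico]
    simp only [hA, sub_zero]
    simp [remaining]
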